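/- There is an absolute constant $C>0$ such that the following holds. Let $d,B\ge 1$ and, for $k\in\{1,\dots,B\}$, let $X^{(k)}_1,\dots,X^{(k)}_{N_k}$ be i.i.d. $\mathcal N(\mu_k,\Sigma_k)$ random vectors in $\mathbb R^d$, with $\Sigma_k\neq 0$ positive semidefinite (possibly singular), the $B$ samples being independent of each other. Let $\hat\mu_k=\frac1{N_k}\sum_{i} X^{(k)}_i$, let $s_k^2=\mathbb E\|\hat\mu_k-\mu_k\|^2=\operatorname{Tr}\Sigma_k/N_k$, and let $d^e_k=\operatorname{Tr}\Sigma_k/\|\Sigma_k\|_\infty$, where $\|\cdot\|_\infty$ is the operator norm. Let $u_0\in\mathbb R$ satisfy $\log(17B)\le u_0\le(\min_k N_k-1)/2$. For $\omega$ in the simplex $\mathcal S_B=\{\omega\in[0,1]^B:\sum_k\omega_k=1\}$ put \[ \hat L_k(\omega)=\Big\|\sum_{\ell\ne k}\omega_\ell(\hat\mu_\ell-\hat\mu_k)\Big\|^2+(2\omega_k-1)\,\frac{1}{N_k(N_k-1)}\sum_{i=1}^{N_k}\|X^{(k)}_i-\hat\mu_k\|^2, \] \[ \hat Q_k(\omega)=\sum_{\ell\neq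 k}\omega_\ell\sqrt{\frac{\hat q_{k,\ell}}{N_k}},\qquad \hat q_{k,\ell}=\frac1{N_k-1}\sum_{i=1}^{N_k}\big\langle\hat\mu_k-\hat\mu_\ell,\;X^{(k)}_i-\hat\mu_k\big\rangle^2 . \] For every $k$ let $\hat\omega_k=(\hat\omega_{k,\ell})_{\ell}$ be a (measurable) random vector with $\hat\omega_k\in\arg\min_{\omega\in\mathcal S_B}\big(\hat L_k(\omega)+16\sqrt{u_0}\,\hat Q_k(\omega)\big)$ almost surely, and let $R_k(\hat\omega_k)=\mathbb E\big\|\sum_{\ell}\hat\omega_{k,\ell}\hat\mu_\ell-\mu_k\big\|^2$. Then these risks are finite and \[ \frac1B\sum_{k=1}^B\frac{R_k(\hat\omega_k)}{s_k^2}\le\big(1+CBe^{-u_0/2}\big)\min_{\mathcal C}\bigg(\mathcal L^*\big(\boldsymbol s,\mathcal C,\operatorname{diam}(\mathcal C,\boldsymbol\mu)\big)+C\,\frac{u_0}{\min_{k}(d^e_k)^{1/2}}\bigg), \] where the minimum is over all partitions $\mathcal C=(\mathcal C_j)_{j\le J}$ of $\{1,\dots,B\}$ (with any number $J$ of groups),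 $\operatorname{diam}(\mathcal C,\boldsymbol\mu)=\big(\max_{k,\ell\in \mathcal C_j}\|\mu_k-\mu_\ell\|\big)_{j\le J}$ and, for $\zeta\in\mathbb R_+^J$, \[ \mathcal L^*(\boldsymbol s,\mathcal C,\zeta)=\frac1B\sum_{j=1}^J\sum_{k\in\mathcal C_j}\mathcal B\Big(\frac{\zeta_j^2}{s_k^2},\frac{s^2(\mathcal C_j)}{s_k^2}\Big),\qquad s^2(\mathcal C_j)=\Big(\sum_{k\in\mathcal C_j}\frac{1}{s_k^{2}}\Big)^{-1}, \] \[ \mathcal B(\tau,\nu)=\frac{\tau}{1+\tau}+\frac1{1+\tau}\cdot\frac{\nu}{1+\tau(1-\nu)}. \] -/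

import Mathlib

open MeasureTheory ProbabilityTheory

noncomputable section

namespace QAggregation

/-- A data set of `B` bags in `ℝ^d`: the `k`-th bag consists of `N k` vectors. -/
abbrev Bags (d B : ℕ) (N : Fin B → ℕ) : Type :=
  (k : Fin B) → Fin (N k) → EuclideanSpace ℝ (Fin d)

variable {d B : ℕ} {N : Fin B → ℕ}

/-- The naive estimator of task `k`: the empirical mean of the `k`-th bag. -/
def naiveMean (x : Bags d B N) (k : Fin B) : EuclideanSpace ℝ (Fin d) :=
  (N k : ℝ)⁻¹ • ∑ i, x k i

/-- The aggregated estimator with weight vector `w`. -/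
def aggregate (x : Bags d B N) (w : Fin B → ℝ) : EuclideanSpace ℝ (Fin d) :=
  ∑ l, w l • naiveMean x l

/-- The estimate of the naive risk of task `k` from its own bag. -/
def naiveRiskEst (x : Bags d B N) (k : Fin B) : ℝ :=
  1 / ((N k : ℝ) * ((N k : ℝ) - 1)) * ∑ i, ‖x k i - naiveMean x k‖ ^ 2

/-- The risk estimate `L̂_k(w)` for target task `k`. -/
def lossEst (x : Bags d B N) (k : Fin B) (w : Fin B → ℝ) : ℝ :=
  ‖∑ l ∈ Finset.univ.erase k, w l • (naiveMean x l - naiveMean x k)‖ ^ 2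
    + (2 * w k - 1) * naiveRiskEst x k

/-- The quantity `q̂_l` for target task `k`. -/
def qEst (x : Bags d B N) (k l : Fin B) : ℝ :=
  1 / ((N k : ℝ) - 1) *
    ∑ i, (inner ℝ (naiveMean x k - naiveMean x l) (x k i - naiveMean x k)) ^ 2

/-- The penalty `Q̂_k(w)` for target task `k`. -/
def penaltyEst (x : Bags d B N) (k : Fin B) (w : Fin B → ℝ) : ℝ :=
  ∑ l ∈ Finset.univ.erase k, w l * √(qEst x k l / (N k : ℝ))

/-- The objective of `Q`-aggregation for target task `k` at calibration level `u₀`. -/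
def objective (u₀ : ℝ) (x : Bags d B N) (k : Fin B) (w : Fin B → ℝ) : ℝ :=
  lossEst x k w + 16 * √u₀ * penaltyEst x k w

/-- `w` is a `Q`-aggregation weight vector for target task `k`: a minimiser of the objective
over the probability simplex. -/
def IsQWeight (u₀ : ℝ) (x : Bags d B N) (k : Fin B) (w : Fin B → ℝ) : Prop :=
  w ∈ stdSimplex ℝ (Fin B) ∧ IsMinOn (objective u₀ x k) (stdSimplex ℝ (Fin B)) w

/-- The squared loss of an estimator, as a function of the outcome. -/
def loss {Ω : Type*} (est : Ω → EuclideanSpace ℝ (Fin d)) (m : EuclideanSpace ℝ (Fin d))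
    (o : Ω) : ℝ :=
  ‖est o - m‖ ^ 2

/-- The risk of an estimator: its expected squared loss. -/
def risk {Ω : Type*} [MeasurableSpace Ω] (P : Measure Ω)
    (est : Ω → EuclideanSpace ℝ (Fin d)) (m : EuclideanSpace ℝ (Fin d)) : ℝ :=
  ∫ o, loss est m o ∂P

/-- The naive risk `s_k²` of task `k`: the risk of its empirical mean. -/
def naiveRisk {Ω : Type*} [MeasurableSpace Ω] (P : Measure Ω) (X : Ω → Bags d B N)
    (μ : Fin B → EuclideanSpace ℝ (Fin d)) (k : Fin B) : ℝ :=
  risk P (fun o => naiveMean (X o) k) (μ k)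

/-- The effective dimension `Tr S / ‖S‖`, with the operator norm for the Euclidean norm. -/
def effDim (S : Matrix (Fin d) (Fin d) ℝ) : ℝ :=
  S.trace / ‖Matrix.toEuclideanCLM (𝕜 := ℝ) S‖

/-- The Gaussian setting: `X` consists of `B` mutually independent bags, the `k`-th one being
an i.i.d. sample of size `N k` from the Gaussian law with mean `μ k` and covariance
matrix `S k`. -/
structure IsGaussianModel {Ω : Type*} [MeasurableSpace Ω] (P : Measure Ω) (X : Ω → Bags d B N)
    (μ : Fin B → EuclideanSpace ℝ (Fin d)) (S : Fin B → Matrix (Fin d) (Fin d) ℝ) : Prop where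
  posSemidef : ∀ k, (S k).PosSemidef
  hasLaw : ∀ k i, HasLaw (fun o => X o k i) (multivariateGaussian (μ k) (S k)) P
  indep : iIndepFun (fun (p : (k : Fin B) × Fin (N k)) (o : Ω) => X o p.1 p.2) P

/-- The function `ℬ(τ, ν)`. -/
def oracleBound (τ ν : ℝ) : ℝ :=
  τ / (1 + τ) + 1 / (1 + τ) * (ν / (1 + τ * (1 - ν)))

/-- The aggregated variance `s²(c) = (∑_{k ∈ c} 1 / s_k²)⁻¹` of a set of tasks, where
`s2 k` stands for `s_k²`. -/
def aggVar (s2 : Fin B → ℝ) (c : Finset (Fin B)) : ℝ :=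
  (∑ k ∈ c, 1 / s2 k)⁻¹

/-- The diameter of a group `c` of tasks: the largest distance between two of its means. -/
def groupDiam (μ : Fin B → EuclideanSpace ℝ (Fin d)) (c : Finset (Fin B)) : ℝ :=
  Metric.diam (μ '' (c : Set (Fin B)))

/-- The compound oracle relative risk `ℒ*` of a partition `𝒞` of the tasks; `s2 k` stands for
`s_k²` and `ζ c` for the diameter bound attached to the group `c`. -/
def compoundOracle (s2 : Fin B → ℝ) (𝒞 : Finpartition (Finset.univ : Finset (Fin B)))
    (ζ : Finset (Fin B) → ℝ) : ℝ :=
  1 / (B : ℝ) * ∑ c ∈ 𝒞.parts, ∑ k ∈ c, oracleBound (ζ c ^ 2 / s2 k) (aggVar s2 c / s2 k)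

end QAggregation

end

noncomputable section

namespace QAggregation

/-! ### Gaussian quadratic exponentials and a tail bound for the Student statistic -/

/-! Fix a task `k` and write `m = μ k`, with `μ̂_l` the empirical means. Expanding the square shows
that for every simplex vector `w` the true loss of the aggregate equals `lossEst`, plus `2 * w k -
1` times the centred quantity `‖μ̂_k - m‖² - naiveRiskEst`, plus the cross terms `2 ∑_{l ≠ k} w l
⟨μ̂_l - m, μ̂_k - m⟩` (`norm_aggregate_sub_sq_eq`). For fixed `w` both corrections have mean zero,
but data-dependent weights may exploit the cross terms.

The cross terms are linear in `w`, so it is enough to control them for each `l`, with a union bound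
over `l` and none over the simplex. Since `μ̂_l` is independent of bag `k`, freezing it turns the
cross term into the mean of a one-dimensional centred Gaussian sample, and a Student tail bound
(`student_tail_of_indepFun`) dominates it by its own empirical standard deviation. The triangle
inequality for that standard deviation replaces the unknown `m` by `μ̂_k`, which produces exactly
the penalty, up to a remainder free of `w`. Hence, off an event of probability `O(B e^{-3u/2})`, the
loss of a minimiser is at most the objective at any competitor plus remainders
(`IsQWeight.norm_aggregate_sub_sq_le_objective`). On the bad event, comparison with the vertex at
`k` bounds the loss by naive quantities. Relative to `s_k²`, the expected remainders are of order `u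
/ √(effDim)`, because the variance of `‖Z‖²` for a Gaussian vector is at most `2 ‖Σ‖ Tr Σ`. This
gives `risk_aggregate_le`.

The competitor moves from the vertex at `k` towards the inverse-variance weights of a group by the
optimal amount, which attains `oracleBound` (`oracleWeight_risk_le`). Its penalty need not be small
for each single task relative to `s_k²`, but by Cauchy-Schwarz it is bounded on average over a group
(`sum_sum_aggVar_le`); this is where averaging over tasks enters. Finally the additive `B e^{-3u/2}`
is absorbed into the multiplicative factor, because the oracle risk is at least `1 / B`
(`one_div_le_compoundOracle`). -/

lemma lintegral_exp_sub_sq_gaussianReal {v : NNReal} (hv : v ≠ 0) {t s : ℝ}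
    (h : 0 < 1 + 2 * s * v) :
    ∫⁻ y, ENNReal.ofReal (Real.exp (t * y - s * y ^ 2)) ∂(gaussianReal 0 v)
      = ENNReal.ofReal ((√(1 + 2 * s * v))⁻¹
          * Real.exp (t ^ 2 * v / (2 * (1 + 2 * s * v)))) := by
  have hv0 : (0 : ℝ) < v := by positivity
  set r : ℝ := 1 + 2 * s * v with hr
  set v' : NNReal := (v / r : ℝ).toNNReal with hv'
  have hv'c : (v' : ℝ) = v / r := Real.coe_toNNReal _ (by positivity)
  have hv'0 : v' ≠ 0 := by
    intro h0
    have : (v / r : ℝ) = 0 := by rw [← hv'c, h0]; rfl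
    exact absurd this (by positivity)
  rw [gaussianReal_of_var_ne_zero _ hv,
    lintegral_withDensity_eq_lintegral_mul _ (measurable_gaussianPDF _ _) (by fun_prop)]
  have key : ∀ y : ℝ, (gaussianPDF 0 v * fun y => ENNReal.ofReal (Real.exp (t * y - s * y ^ 2))) y
      = ENNReal.ofReal ((√r)⁻¹ * Real.exp (t ^ 2 * v / (2 * r)))
        * gaussianPDF (t * v') v' y := by
    intro y
    simp only [Pi.mul_apply, gaussianPDF]
    rw [← ENNReal.ofReal_mul (gaussianPDFReal_nonneg _ _ _), ← ENNReal.ofReal_mul (by positivity)]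
    congr 1
    simp only [gaussianPDFReal, hv'c]
    have e1 : (√(2 * Real.pi * (v / r)))⁻¹ = √r * (√(2 * Real.pi * v))⁻¹ := by
      rw [show 2 * Real.pi * (v / r) = (2 * Real.pi * v) / r by ring, Real.sqrt_div (by positivity)]
      field_simp
    have hsr : √r ≠ 0 := by positivity
    rw [e1, mul_assoc, ← Real.exp_add,
      show (√r)⁻¹ * Real.exp (t ^ 2 * v / (2 * r)) * (√r * (√(2 * Real.pi * v))⁻¹
        * Real.exp (-(y - t * (v / r)) ^ 2 / (2 * (v / r))))
        = (√(2 * Real.pi * v))⁻¹ * (Real.exp (t ^ 2 * v / (2 * r))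
          * Real.exp (-(y - t * (v / r)) ^ 2 / (2 * (v / r)))) by field_simp,
      ← Real.exp_add]
    congr 2
    have hrne : r ≠ 0 := h.ne'
    field_simp
    rw [hr]
    ring
  rw [lintegral_congr key, lintegral_const_mul _ (measurable_gaussianPDF _ _),
    lintegral_gaussianPDF_eq_one _ hv'0, mul_one]

lemma lintegral_exp_sum_pi_gaussianReal {n : ℕ} {v : NNReal} (hv : v ≠ 0) {t s : ℝ}
    (h : 0 < 1 + 2 * s * v) :
    ∫⁻ y, ENNReal.ofReal (Real.exp (t * ∑ i, y i - s * ∑ i, y i ^ 2))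
        ∂(Measure.pi fun _ : Fin n => gaussianReal 0 v)
      = ENNReal.ofReal ((√(1 + 2 * s * v))⁻¹ ^ n
          * Real.exp (n * (t ^ 2 * v / (2 * (1 + 2 * s * v))))) := by
  have e : ∀ y : Fin n → ℝ, ENNReal.ofReal (Real.exp (t * ∑ i, y i - s * ∑ i, y i ^ 2))
      = ∏ i, ENNReal.ofReal (Real.exp (t * y i - s * y i ^ 2)) := by
    intro y
    rw [← ENNReal.ofReal_prod_of_nonneg (fun _ _ => (Real.exp_pos _).le), ← Real.exp_sum,
      Finset.sum_sub_distrib, Finset.mul_sum, Finset.mul_sum]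
  have hind : iIndepFun (fun (i : Fin n) (y : Fin n → ℝ) =>
      ENNReal.ofReal (Real.exp (t * y i - s * y i ^ 2)))
      (Measure.pi fun _ : Fin n => gaussianReal 0 v) :=
    iIndepFun_pi (X := fun _ (z : ℝ) => ENNReal.ofReal (Real.exp (t * z - s * z ^ 2)))
      (fun _ => by fun_prop)
  rw [lintegral_congr e, lintegral_prod_eq_prod_lintegral_of_indepFun _ _ hind
    (fun _ => by fun_prop)]
  have e2 : ∀ i : Fin n, ∫⁻ y, ENNReal.ofReal (Real.exp (t * y i - s * y i ^ 2))
      ∂(Measure.pi fun _ : Fin n => gaussianReal 0 v)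
      = ENNReal.ofReal ((√(1 + 2 * s * v))⁻¹
          * Real.exp (t ^ 2 * v / (2 * (1 + 2 * s * v)))) := by
    intro i
    rw [← lintegral_exp_sub_sq_gaussianReal hv h]
    exact (measurePreserving_eval (fun _ : Fin n => gaussianReal 0 v) i).lintegral_comp
      (f := fun z => ENNReal.ofReal (Real.exp (t * z - s * z ^ 2))) (by fun_prop)
  simp_rw [e2]
  rw [Finset.prod_const, Finset.card_univ, Fintype.card_fin, ← ENNReal.ofReal_pow (by positivity),
    mul_pow, ← Real.exp_nat_mul]

/-- The square of `A = ∑ y i` is linearised by `exp (b² A² / 2) = E exp (b z A)` with `z` standard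
normal; the integral over `y` then factorises and one more Gaussian integral in `z` remains. The
value is the product of the Laplace transforms of the independent chi-square variables `A² / (n v)`
and `(∑ y i ² - A² / n) / v`, of 1 and `n - 1` degrees of freedom. -/
lemma lintegral_exp_sq_sum_pi_gaussianReal {n : ℕ} (hn : 0 < n) {v : NNReal} (hv : v ≠ 0)
    {κ : ℝ} (hκ : 0 ≤ κ) :
    ∫⁻ y, ENNReal.ofReal (Real.exp ((4 * v : ℝ)⁻¹ *
          ((1 + κ) * (∑ i, y i) ^ 2 / n - κ * ∑ i, y i ^ 2)))
        ∂(Measure.pi fun _ : Fin n => gaussianReal 0 v)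
      = ENNReal.ofReal (√2 * √(1 + κ / 2) * (√(1 + κ / 2))⁻¹ ^ n) := by
  have hv0 : (0 : ℝ) < v := by positivity
  have hn0 : (0 : ℝ) < n := by positivity
  -- Chosen so that `b² / 2` is the coefficient `(1 + κ) / (4 v n)` of `A²` in the exponent.
  set b : ℝ := √((1 + κ) / (2 * v * n)) with hb
  have hb2 : b ^ 2 = (1 + κ) / (2 * v * n) := Real.sq_sqrt (by positivity)
  set s : ℝ := κ / (4 * v) with hs
  have hsv : 1 + 2 * s * v = 1 + κ / 2 := by rw [hs]; field_simp; ring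
  have hpos : 0 < 1 + 2 * s * v := by rw [hsv]; positivity
  have e1 : ∀ y : Fin n → ℝ, ENNReal.ofReal (Real.exp ((4 * v : ℝ)⁻¹ *
          ((1 + κ) * (∑ i, y i) ^ 2 / n - κ * ∑ i, y i ^ 2)))
      = ∫⁻ z, ENNReal.ofReal (Real.exp ((b * z) * ∑ i, y i - s * ∑ i, y i ^ 2))
        ∂(gaussianReal 0 1) := by
    intro y
    have e : ∀ z : ℝ, ENNReal.ofReal (Real.exp ((b * z) * ∑ i, y i - s * ∑ i, y i ^ 2))
        = ENNReal.ofReal (Real.exp (- (s * ∑ i, y i ^ 2))) *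
          ENNReal.ofReal (Real.exp ((b * ∑ i, y i) * z - 0 * z ^ 2)) := by
      intro z
      rw [← ENNReal.ofReal_mul (Real.exp_pos _).le, ← Real.exp_add]
      congr 2; ring
    simp_rw [e]
    rw [lintegral_const_mul _ (by fun_prop),
      lintegral_exp_sub_sq_gaussianReal one_ne_zero (by simp),
      ← ENNReal.ofReal_mul (Real.exp_pos _).le]
    congr 1
    simp only [mul_zero, add_zero, Real.sqrt_one, inv_one, one_mul, mul_pow, hb2,
      NNReal.coe_one, mul_one]
    rw [← Real.exp_add]
    congr 1
    rw [hs]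
    field_simp
    ring
  rw [lintegral_congr e1, lintegral_lintegral_swap (by fun_prop)]
  have e2 : ∀ z : ℝ, ∫⁻ y, ENNReal.ofReal (Real.exp ((b * z) * ∑ i, y i - s * ∑ i, y i ^ 2))
        ∂(Measure.pi fun _ : Fin n => gaussianReal 0 v)
      = ENNReal.ofReal ((√(1 + κ / 2))⁻¹ ^ n) *
        ENNReal.ofReal (Real.exp (0 * z - (-((1 + κ) / (4 * (1 + κ / 2)))) * z ^ 2)) := by
    intro z
    rw [lintegral_exp_sum_pi_gaussianReal hv hpos, hsv, ← ENNReal.ofReal_mul (by positivity)]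
    congr 3
    rw [mul_pow, hb2]
    field_simp
    ring
  have h3 : (1 : ℝ) + 2 * -((1 + κ) / (4 * (1 + κ / 2))) * (1 : NNReal) = (2 * (1 + κ / 2))⁻¹ := by
    simp only [NNReal.coe_one]; field_simp; ring
  rw [lintegral_congr e2, lintegral_const_mul _ (by fun_prop),
    lintegral_exp_sub_sq_gaussianReal one_ne_zero (by rw [h3]; positivity), h3,
    ← ENNReal.ofReal_mul (by positivity)]
  congr 1
  simp only [ne_eq, OfNat.ofNat_ne_zero, not_false_eq_true, zero_pow, zero_mul, zero_div,
    Real.exp_zero, mul_one]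
  rw [Real.sqrt_inv, inv_inv, Real.sqrt_mul (by norm_num)]
  ring

/-- The quadratic event behind the Student statistic of a centred Gaussian sample. -/
lemma measure_pi_gaussianReal_student_le {n : ℕ} {v : NNReal} (hv : v ≠ 0) {u : ℝ} (hu : 0 < u)
    (hn : u ≤ ((n : ℝ) - 1) / 2) :
    (Measure.pi fun _ : Fin n => gaussianReal 0 v)
        {y | 0 ≤ ((n : ℝ) - 1 + 64 * u) * (∑ i, y i) ^ 2 / n - 64 * u * ∑ i, y i ^ 2}
      ≤ ENNReal.ofReal (√2 * Real.exp (-(3 / 2 * u))) := by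
  have hv0 : (0 : ℝ) < v := by positivity
  have hm : 0 < (n : ℝ) - 1 := by linarith
  have hn0 : 0 < n := by
    rcases Nat.eq_zero_or_pos n with rfl | h
    · norm_num at hm
    · exact h
  have hnR : (0 : ℝ) < n := by positivity
  set m : ℝ := (n : ℝ) - 1 with hm_def
  -- With this `κ` the exponent is a positive multiple of the quadratic form defining the event, so
  -- Markov's inequality at level 1 applies. The bound `κ ≤ 32` is the hypothesis `u ≤ m / 2`.
  set κ : ℝ := 64 * u / m with hκ_def
  have hκ : 0 ≤ κ := by positivity
  have hκ32 : κ ≤ 32 := by rw [hκ_def, div_le_iff₀ hm]; linarith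
  have hum : u = κ * m / 64 := by rw [hκ_def]; field_simp
  calc (Measure.pi fun _ : Fin n => gaussianReal 0 v)
        {y | 0 ≤ (m + 64 * u) * (∑ i, y i) ^ 2 / n - 64 * u * ∑ i, y i ^ 2}
      ≤ (Measure.pi fun _ : Fin n => gaussianReal 0 v)
        {y | 1 ≤ ENNReal.ofReal (Real.exp ((4 * v : ℝ)⁻¹ *
          ((1 + κ) * (∑ i, y i) ^ 2 / n - κ * ∑ i, y i ^ 2)))} := by
        apply measure_mono
        intro y hy
        simp only [Set.mem_ofPred_eq] at hy ⊢
        rw [← ENNReal.ofReal_one]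
        apply ENNReal.ofReal_le_ofReal
        apply Real.one_le_exp
        have : (1 + κ) * (∑ i, y i) ^ 2 / n - κ * ∑ i, y i ^ 2
          = m⁻¹ * ((m + 64 * u) * (∑ i, y i) ^ 2 / n - 64 * u * ∑ i, y i ^ 2) := by
          rw [hκ_def]; field_simp
        rw [this]
        positivity
    _ ≤ (∫⁻ y, ENNReal.ofReal (Real.exp ((4 * v : ℝ)⁻¹ *
          ((1 + κ) * (∑ i, y i) ^ 2 / n - κ * ∑ i, y i ^ 2)))
        ∂(Measure.pi fun _ : Fin n => gaussianReal 0 v)) / 1 :=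
        meas_ge_le_lintegral_div (Measurable.aemeasurable (by fun_prop)) one_ne_zero ENNReal.one_ne_top
    _ ≤ _ := by
        rw [div_one, lintegral_exp_sq_sum_pi_gaussianReal hn0 hv hκ]
        apply ENNReal.ofReal_le_ofReal
        rw [mul_assoc]
        apply mul_le_mul_of_nonneg_left _ (by positivity)
        have hq : 0 < 1 + κ / 2 := by positivity
        have hs : √(1 + κ / 2) = Real.exp (Real.log (1 + κ / 2) / 2) := by
          rw [Real.exp_half, Real.exp_log hq]
        rw [hs, ← Real.exp_neg, ← Real.exp_nat_mul, ← Real.exp_add]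
        apply Real.exp_le_exp.2
        have hl := Real.le_log_one_add_of_nonneg (x := κ / 2) (by positivity)
        -- The denominator is at most 18 since `κ ≤ 32`. The slope `3 / 64` is what the target rate
        -- requires: `κ m = 64 u`, so `(m / 2) (3 κ / 64) = 3 u / 2`.
        have h1 : 3 * κ / 64 ≤ 2 * (κ / 2) / (κ / 2 + 2) := by
          rw [le_div_iff₀ (by positivity)]
          nlinarith
        have h2 : 3 * κ / 64 ≤ Real.log (1 + κ / 2) := h1.trans hl
        have h3 : m / 2 * (3 * κ / 64) ≤ m / 2 * Real.log (1 + κ / 2) := by gcongr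
        have h4 : (n : ℝ) = m + 1 := by rw [hm_def]; ring
        rw [hum, h4]
        linarith

/-- Squaring the one-sided event puts it inside the quadratic event for the law of the sample; the
threshold 64 there is `16² / 2²`. -/
lemma student_tail {Ω : Type*} [MeasurableSpace Ω] {P : Measure Ω} [IsProbabilityMeasure P]
    {n : ℕ} {v : NNReal} {Y : Fin n → Ω → ℝ} (hlaw : ∀ i, HasLaw (Y i) (gaussianReal 0 v) P)
    (hind : iIndepFun Y P) {u : ℝ} (hu : 0 < u) (hn : u ≤ ((n : ℝ) - 1) / 2) :
    P {o | 16 * √u * √(1 / ((n : ℝ) - 1)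
        * ∑ i, (Y i o - (n : ℝ)⁻¹ * ∑ j, Y j o) ^ 2 / n) < 2 * ((n : ℝ)⁻¹ * ∑ i, Y i o)}
      ≤ ENNReal.ofReal (√2 * Real.exp (-(3 / 2 * u))) := by
  have hm : 0 < (n : ℝ) - 1 := by linarith
  have hn0 : (0 : ℝ) < n := by linarith
  rcases eq_or_ne v 0 with rfl | hv
  -- For zero variance both sides vanish almost surely, and the event is null because its inequality
  -- is strict.
  · have h0 : ∀ᵐ o ∂P, ∀ i, Y i o = 0 := by
      rw [ae_all_iff]
      intro i
      have h1 : ∀ᵐ z ∂(P.map (Y i)), z = 0 := by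
        rw [(hlaw i).map_eq, gaussianReal_zero_var]
        exact (ae_dirac_iff (p := fun z : ℝ => z = 0) (measurableSet_singleton _)).2 rfl
      exact ae_of_ae_map (hlaw i).aemeasurable h1
    refine le_of_eq_of_le ?_ zero_le
    rw [measure_eq_zero_iff_ae_notMem]
    filter_upwards [h0] with o ho
    simp [ho]
  · set S : Set (Fin n → ℝ) :=
      {y | 0 ≤ ((n : ℝ) - 1 + 64 * u) * (∑ i, y i) ^ 2 / n - 64 * u * ∑ i, y i ^ 2} with hS
    have hmap : P.map (fun o i => Y i o) = Measure.pi fun _ : Fin n => gaussianReal 0 v := by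
      rw [(iIndepFun_iff_map_fun_eq_pi_map fun i => (hlaw i).aemeasurable).1 hind]
      congr 1
      funext i
      exact (hlaw i).map_eq
    have hSm : MeasurableSet S := measurableSet_le (by fun_prop) (by fun_prop)
    refine le_trans (measure_mono ?_) ((Measure.map_apply_of_aemeasurable
      (aemeasurable_pi_lambda _ fun i => (hlaw i).aemeasurable) hSm).symm.le.trans
      (hmap ▸ measure_pi_gaussianReal_student_le hv hu hn))
    intro o ho
    simp only [Set.mem_ofPred_eq, Set.mem_preimage, hS] at ho ⊢
    set A := ∑ i, Y i o with hA
    set Q := ∑ i, Y i o ^ 2 with hQ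
    have hV : ∑ i, (Y i o - (n : ℝ)⁻¹ * A) ^ 2 / n = (Q - A ^ 2 / n) / n := by
      rw [← Finset.sum_div]
      congr 1
      simp_rw [sub_sq, Finset.sum_add_distrib, Finset.sum_sub_distrib, ← Finset.sum_mul,
        ← Finset.mul_sum]
      rw [← hA, ← hQ]
      simp only [Finset.sum_const, Finset.card_univ, Fintype.card_fin, nsmul_eq_mul]
      field_simp
      ring
    have hVn : 0 ≤ 1 / ((n : ℝ) - 1) * ∑ i, (Y i o - (n : ℝ)⁻¹ * A) ^ 2 / n := by positivity
    have h2 := pow_le_pow_left₀ (by positivity) ho.le 2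
    rw [mul_pow, mul_pow, Real.sq_sqrt hu.le, Real.sq_sqrt hVn, hV] at h2
    have h3 : ((n : ℝ) - 1) * n / 4 * (16 ^ 2 * u * (1 / ((n : ℝ) - 1) * ((Q - A ^ 2 / n) / n)))
      ≤ ((n : ℝ) - 1) * n / 4 * (2 * ((n : ℝ)⁻¹ * A)) ^ 2 := by gcongr
    have e1 : ((n : ℝ) - 1) * n / 4 * (16 ^ 2 * u * (1 / ((n : ℝ) - 1) * ((Q - A ^ 2 / n) / n)))
      = 64 * u * (Q - A ^ 2 / n) := by field_simp; ring
    have e2 : ((n : ℝ) - 1) * n / 4 * (2 * ((n : ℝ)⁻¹ * A)) ^ 2 = ((n : ℝ) - 1) * A ^ 2 / n := by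
      field_simp
      ring
    rw [e1, e2] at h3
    have e3 : ((n : ℝ) - 1 + 64 * u) * A ^ 2 / n
      = ((n : ℝ) - 1) * A ^ 2 / n + 64 * u * (A ^ 2 / n) := by ring
    rw [e3]
    linarith

/-! ### Moments of Gaussian vectors -/

lemma integral_pow_four_gaussianReal (v : NNReal) :
    ∫ x, x ^ 4 ∂(gaussianReal 0 v) = 3 * (v : ℝ) ^ 2 := by
  have h := iteratedDeriv_mgf_zero (X := id) (μ := gaussianReal 0 v) (by simp) 4
  simp only [Pi.pow_apply, id_eq] at h
  rw [← h, mgf_id_gaussianReal]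
  -- Differentiating `p * exp (v t² / 2)` replaces the polynomial `p` by `p' + v t p`; four rounds
  -- starting from `p = 1` give the fourth derivative at 0.
  have d : ∀ (p p' : ℝ → ℝ), (∀ t, HasDerivAt p (p' t) t) →
      deriv (fun t => p t * Real.exp (0 * t + v * t ^ 2 / 2))
        = fun t => (p' t + p t * (v * t)) * Real.exp (0 * t + v * t ^ 2 / 2) := by
    intro p p' hp
    funext t
    have h1 : HasDerivAt (fun t : ℝ => 0 * t + (v : ℝ) * t ^ 2 / 2) (v * t) t := by
      have := ((hasDerivAt_id t).const_mul (0 : ℝ)).add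
        ((((hasDerivAt_id t).pow 2).const_mul (v : ℝ)).div_const 2)
      convert! this using 1
      simp
      ring
    have := ((hp t).mul h1.exp).deriv
    rw [show (fun t => p t * Real.exp (0 * t + v * t ^ 2 / 2))
      = p * fun t => Real.exp (0 * t + v * t ^ 2 / 2) from rfl, this]
    ring
  have e0 : (fun t : ℝ => Real.exp (0 * t + v * t ^ 2 / 2))
    = fun t => 1 * Real.exp (0 * t + v * t ^ 2 / 2) := by simp
  have hid : ∀ (c t : ℝ), HasDerivAt (fun t : ℝ => c * t) c t := fun c t => by
    simpa using (hasDerivAt_id t).const_mul c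
  have hsq : ∀ (c t : ℝ), HasDerivAt (fun t : ℝ => c * t ^ 2) (2 * c * t) t := fun c t => by
    have := (hasDerivAt_pow 2 t).const_mul c
    convert! this using 1
    push_cast
    ring
  have hcu : ∀ (c t : ℝ), HasDerivAt (fun t : ℝ => c * t ^ 3) (3 * c * t ^ 2) t := fun c t => by
    have := (hasDerivAt_pow 3 t).const_mul c
    convert! this using 1
    push_cast
    ring
  rw [iteratedDeriv_succ', iteratedDeriv_succ', iteratedDeriv_succ', iteratedDeriv_one, e0,
    d _ _ (fun t => hasDerivAt_const t 1),
    d _ (fun t => (v : ℝ)) (fun t => by simpa using hid (v : ℝ) t),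
    d _ (fun t => 2 * (v : ℝ) ^ 2 * t) (fun t => by
      have := (hasDerivAt_const t (v : ℝ)).add (hsq ((v : ℝ) ^ 2) t)
      convert! this using 1
      · funext s; simp; ring
      · ring),
    d _ (fun t => 3 * (v : ℝ) ^ 2 + 3 * (v : ℝ) ^ 3 * t ^ 2) (fun t => by
      have := (hid (3 * (v : ℝ) ^ 2) t).add (hcu ((v : ℝ) ^ 3) t)
      convert! this using 1
      funext s; simp; ring)]
  simp

lemma integral_abs_le_sqrt_integral_sq {Ω : Type*} [MeasurableSpace Ω] {P : Measure Ω}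
    [IsProbabilityMeasure P] {f : Ω → ℝ} (hf : MemLp f 2 P) :
    ∫ o, |f o| ∂P ≤ √(∫ o, f o ^ 2 ∂P) := by
  have h := variance_nonneg (fun o => |f o|) P
  rw [variance_eq_sub (X := fun o => |f o|) hf.abs] at h
  apply Real.le_sqrt_of_sq_le
  simpa [sq_abs] using h

section Moments

variable {E : Type*} [NormedAddCommGroup E] [InnerProductSpace ℝ E] {T : E →L[ℝ] E}

/-- Positivity of `T` tested at `v - ‖T‖⁻¹ • T v`; no square root of `T` is needed. -/
lemma norm_apply_sq_le_of_isPositive (hT : T.IsPositive) (v : E) :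
    ‖T v‖ ^ 2 ≤ ‖T‖ * inner ℝ v (T v) := by
  rcases eq_or_ne T 0 with rfl | h0
  · simp
  have hop : 0 < ‖T‖ := norm_pos_iff.2 h0
  set t := ‖T‖⁻¹ with ht
  have h := hT.inner_nonneg_right (v - t • T v)
  have hsymm : inner ℝ (T v) (T v) = inner ℝ v (T (T v)) := hT.isSymmetric v (T v)
  simp only [map_sub, map_smul, inner_sub_left, inner_sub_right, real_inner_smul_left,
    real_inner_smul_right] at h
  rw [← hsymm, real_inner_self_eq_norm_sq] at h
  have h2 : inner ℝ (T v) (T (T v)) ≤ ‖T‖ * ‖T v‖ ^ 2 :=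
    (real_inner_le_norm _ _).trans (by
      have := T.le_opNorm (T v)
      nlinarith [norm_nonneg (T v)])
  have h3 : t * (t * inner ℝ (T v) (T (T v))) ≤ t * ‖T v‖ ^ 2 := by
    have : t * inner ℝ (T v) (T (T v)) ≤ t * (‖T‖ * ‖T v‖ ^ 2) := by gcongr
    have e : t * (‖T‖ * ‖T v‖ ^ 2) = ‖T v‖ ^ 2 := by rw [ht]; field_simp
    rw [e] at this
    gcongr
  have h4 : t * ‖T v‖ ^ 2 ≤ inner ℝ v (T v) := by linarith
  have h5 : ‖T‖ * (t * ‖T v‖ ^ 2) ≤ ‖T‖ * inner ℝ v (T v) := by gcongr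
  rwa [ht, mul_inv_cancel_left₀ hop.ne'] at h5

lemma inner_apply_le_of_isPositive (v : E) : inner ℝ v (T v) ≤ ‖T‖ * ‖v‖ ^ 2 := by
  refine (real_inner_le_norm _ _).trans ?_
  have := T.le_opNorm v
  nlinarith [norm_nonneg v]

/-- The squared Hilbert-Schmidt norm, which governs the variance of `‖Z‖²`, is at most operator norm
times trace. The effective dimension enters through this bound. -/
lemma sum_sum_inner_sq_le {ι : Type*} [Fintype ι] (b : OrthonormalBasis ι ℝ E)
    (hT : T.IsPositive) :
    ∑ i, ∑ j, inner ℝ (b i) (T (b j)) ^ 2 ≤ ‖T‖ * ∑ i, inner ℝ (b i) (T (b i)) := by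
  rw [Finset.sum_comm, Finset.mul_sum]
  refine Finset.sum_le_sum fun j _ => ?_
  rw [b.sum_sq_inner_right]
  exact norm_apply_sq_le_of_isPositive hT _

variable {Ω : Type*} [MeasurableSpace Ω]
  {P : Measure Ω} {Z : Ω → E} {c : ℝ}

/-- `Z` is a centred random vector all of whose projections are Gaussian, with covariance
operator `c • T`. -/
def IsCenteredGaussian (P : Measure Ω) (Z : Ω → E) (c : ℝ) (T : E →L[ℝ] E) : Prop :=
  ∀ v, HasLaw (fun o => inner ℝ v (Z o)) (gaussianReal 0 (c * inner ℝ v (T v)).toNNReal) P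

namespace IsCenteredGaussian

lemma integrable_pow (h : IsCenteredGaussian P Z c T) (v : E) (n : ℕ) :
    Integrable (fun o => inner ℝ v (Z o) ^ n) P := by
  have h1 : Integrable (fun x : ℝ => x ^ n) (gaussianReal 0 (c * inner ℝ v (T v)).toNNReal) := by
    rcases n with _ | n
    · simp
    have := (memLp_id_gaussianReal (μ := 0) (v := (c * inner ℝ v (T v)).toNNReal)
      ((n + 1 : ℕ) : NNReal))
    have h2 := MemLp.integrable_norm_pow (p := n + 1) (by simpa using this) (by simp)
    refine h2.mono' (by fun_prop) (Filter.Eventually.of_forall fun x => ?_)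
    simp
  rw [← (h v).map_eq] at h1
  exact h1.comp_aemeasurable (h v).aemeasurable

lemma integral_inner (h : IsCenteredGaussian P Z c T) (v : E) :
    ∫ o, inner ℝ v (Z o) ∂P = 0 := by
  rw [(h v).integral_eq, integral_id_gaussianReal]

lemma integral_inner_sq (hc : 0 ≤ c) (hT : T.IsPositive) (h : IsCenteredGaussian P Z c T) (v : E) :
    ∫ o, inner ℝ v (Z o) ^ 2 ∂P = c * inner ℝ v (T v) := by
  have h1 : Var[fun o => inner ℝ v (Z o); P] = c * inner ℝ v (T v) := by
    rw [(h v).variance_eq, variance_id_gaussianReal, Real.coe_toNNReal]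
    exact mul_nonneg hc (hT.inner_nonneg_right v)
  rw [variance_of_integral_eq_zero (h v).aemeasurable (h.integral_inner v)] at h1
  exact h1

lemma integral_inner_pow_four (hc : 0 ≤ c) (hT : T.IsPositive) (h : IsCenteredGaussian P Z c T)
    (v : E) : ∫ o, inner ℝ v (Z o) ^ 4 ∂P = 3 * (c * inner ℝ v (T v)) ^ 2 := by
  have := (h v).integral_comp (f := fun x : ℝ => x ^ 4) (by fun_prop)
  simp only [Function.comp_def] at this
  rw [this, integral_pow_four_gaussianReal, Real.coe_toNNReal]
  exact mul_nonneg hc (hT.inner_nonneg_right v)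

/-- Polarisation: mixed moments reduce to fourth moments of single projections, the only ones that
the definition of `IsCenteredGaussian` gives directly. -/
lemma sq_mul_sq_eq (x y : ℝ) :
    x ^ 2 * y ^ 2 = 1 / 12 * ((x + y) ^ 4 + (x - y) ^ 4 - 2 * x ^ 4 - 2 * y ^ 4) := by ring

lemma integrable_sq_mul_sq (h : IsCenteredGaussian P Z c T) (v w : E) :
    Integrable (fun o => inner ℝ v (Z o) ^ 2 * inner ℝ w (Z o) ^ 2) P := by
  simp_rw [sq_mul_sq_eq, ← inner_add_left, ← inner_sub_left]
  exact ((((h.integrable_pow _ 4).add (h.integrable_pow _ 4)).sub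
    ((h.integrable_pow _ 4).const_mul 2)).sub ((h.integrable_pow _ 4).const_mul 2)).const_mul _

lemma integral_sq_mul_sq (hc : 0 ≤ c) (hT : T.IsPositive) (h : IsCenteredGaussian P Z c T)
    (v w : E) :
    ∫ o, inner ℝ v (Z o) ^ 2 * inner ℝ w (Z o) ^ 2 ∂P
      = c ^ 2 * (inner ℝ v (T v) * inner ℝ w (T w) + 2 * inner ℝ v (T w) ^ 2) := by
  simp_rw [sq_mul_sq_eq, ← inner_add_left, ← inner_sub_left]
  have hi := fun u => h.integrable_pow u 4
  have h1 : Integrable (fun o => inner ℝ (v + w) (Z o) ^ 4 + inner ℝ (v - w) (Z o) ^ 4) P :=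
    (hi _).add (hi _)
  have h2 : Integrable (fun o => inner ℝ (v + w) (Z o) ^ 4 + inner ℝ (v - w) (Z o) ^ 4
    - 2 * inner ℝ v (Z o) ^ 4) P := h1.sub ((hi _).const_mul 2)
  rw [integral_const_mul, integral_sub h2 ((hi _).const_mul 2),
    integral_sub h1 ((hi _).const_mul 2), integral_add (hi _) (hi _), integral_const_mul,
    integral_const_mul]
  simp_rw [h.integral_inner_pow_four hc hT]
  have hs : inner ℝ w (T v) = inner ℝ v (T w) := by
    rw [real_inner_comm]; exact hT.isSymmetric v w
  simp only [map_add, map_sub, inner_add_left, inner_add_right, inner_sub_left, inner_sub_right, hs]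
  ring

variable {ι : Type*} [Fintype ι]

lemma norm_sq_eq_sum (b : OrthonormalBasis ι ℝ E) (z : E) : ‖z‖ ^ 2 = ∑ i, inner ℝ (b i) z ^ 2 :=
  (b.sum_sq_inner_right z).symm

lemma integrable_norm_sq (b : OrthonormalBasis ι ℝ E) (h : IsCenteredGaussian P Z c T) :
    Integrable (fun o => ‖Z o‖ ^ 2) P := by
  simp_rw [norm_sq_eq_sum b]
  exact integrable_finsetSum _ fun i _ => h.integrable_pow _ 2

lemma integral_norm_sq (b : OrthonormalBasis ι ℝ E) (hc : 0 ≤ c) (hT : T.IsPositive)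
    (h : IsCenteredGaussian P Z c T) :
    ∫ o, ‖Z o‖ ^ 2 ∂P = c * ∑ i, inner ℝ (b i) (T (b i)) := by
  simp_rw [norm_sq_eq_sum b]
  rw [integral_finsetSum _ fun i _ => h.integrable_pow _ 2, Finset.mul_sum]
  exact Finset.sum_congr rfl fun i _ => h.integral_inner_sq hc hT _

lemma norm_pow_four_eq_sum (b : OrthonormalBasis ι ℝ E) (z : E) :
    ‖z‖ ^ 4 = ∑ i, ∑ j, inner ℝ (b i) z ^ 2 * inner ℝ (b j) z ^ 2 := by
  rw [show ‖z‖ ^ 4 = ‖z‖ ^ 2 * ‖z‖ ^ 2 by ring, norm_sq_eq_sum b, Finset.sum_mul_sum]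

lemma integrable_norm_pow_four (b : OrthonormalBasis ι ℝ E) (h : IsCenteredGaussian P Z c T) :
    Integrable (fun o => ‖Z o‖ ^ 4) P := by
  simp_rw [norm_pow_four_eq_sum b]
  exact integrable_finsetSum _ fun i _ => integrable_finsetSum _ fun j _ =>
    h.integrable_sq_mul_sq _ _

lemma integral_norm_pow_four_le (b : OrthonormalBasis ι ℝ E) (hc : 0 ≤ c) (hT : T.IsPositive)
    (h : IsCenteredGaussian P Z c T) :
    ∫ o, ‖Z o‖ ^ 4 ∂P ≤ (c * ∑ i, inner ℝ (b i) (T (b i))) ^ 2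
      + 2 * c ^ 2 * (‖T‖ * ∑ i, inner ℝ (b i) (T (b i))) := by
  simp_rw [norm_pow_four_eq_sum b]
  rw [integral_finsetSum _ fun i _ => integrable_finsetSum _ fun j _ =>
    h.integrable_sq_mul_sq _ _]
  simp_rw [integral_finsetSum _ fun j _ => h.integrable_sq_mul_sq _ _,
    h.integral_sq_mul_sq hc hT, mul_add, Finset.sum_add_distrib]
  apply add_le_add
  · rw [mul_pow, sq (∑ i, _), Finset.sum_mul_sum, Finset.mul_sum]
    exact (Finset.sum_congr rfl fun i _ => by rw [Finset.mul_sum]).le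
  · rw [show 2 * c ^ 2 * (‖T‖ * ∑ i, inner ℝ (b i) (T (b i)))
      = c ^ 2 * (2 * (‖T‖ * ∑ i, inner ℝ (b i) (T (b i)))) by ring]
    simp_rw [← Finset.mul_sum]
    gcongr
    exact sum_sum_inner_sq_le b hT

/-- The variance of `‖Z‖²` is at most `2 c² ‖T‖ Tr T`. Relative to the mean `c Tr T` (when nonzero),
the deviation is thus at most `√2` over the square root of the effective dimension. -/
lemma integral_abs_norm_sq_sub_le [IsProbabilityMeasure P] (b : OrthonormalBasis ι ℝ E) (hc : 0 ≤ c) (hT : T.IsPositive)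
    (h : IsCenteredGaussian P Z c T) :
    ∫ o, |‖Z o‖ ^ 2 - c * ∑ i, inner ℝ (b i) (T (b i))| ∂P
      ≤ √2 * (c * √(‖T‖ * ∑ i, inner ℝ (b i) (T (b i)))) := by
  set τ := ∑ i, inner ℝ (b i) (T (b i)) with hτ
  have i2 := h.integrable_norm_sq b
  have i4 := h.integrable_norm_pow_four b
  have e : ∀ o, (‖Z o‖ ^ 2 - c * τ) ^ 2 = ‖Z o‖ ^ 4 - 2 * (c * τ) * ‖Z o‖ ^ 2 + (c * τ) ^ 2 :=
    fun o => by ring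
  have hint : Integrable (fun o => (‖Z o‖ ^ 2 - c * τ) ^ 2) P := by
    simp_rw [e]
    exact (i4.sub (i2.const_mul _)).add (integrable_const _)
  have hm : MemLp (fun o => ‖Z o‖ ^ 2 - c * τ) 2 P :=
    (memLp_two_iff_integrable_sq (i2.aestronglyMeasurable.sub aestronglyMeasurable_const)).2 hint
  refine (integral_abs_le_sqrt_integral_sq hm).trans ?_
  have hτ0 : 0 ≤ τ := Finset.sum_nonneg fun i _ => hT.inner_nonneg_right _
  have hle : ∫ o, (‖Z o‖ ^ 2 - c * τ) ^ 2 ∂P ≤ 2 * (c ^ 2 * (‖T‖ * τ)) := by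
    simp_rw [e]
    have i42 : Integrable (fun o => ‖Z o‖ ^ 4 - 2 * (c * τ) * ‖Z o‖ ^ 2) P :=
      i4.sub (i2.const_mul _)
    rw [integral_add i42 (integrable_const _),
      integral_sub i4 (i2.const_mul _), integral_const_mul, h.integral_norm_sq b hc hT]
    have := h.integral_norm_pow_four_le b hc hT
    simp only [integral_const, probReal_univ, smul_eq_mul, one_mul]
    rw [← hτ] at *
    linarith
  refine (Real.sqrt_le_sqrt hle).trans (le_of_eq ?_)
  rw [Real.sqrt_mul (by norm_num), Real.sqrt_mul (by positivity), Real.sqrt_sq hc]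

end IsCenteredGaussian

end Moments

/-! ### Freezing an independent variable -/

section Indep

variable {Ω α β : Type*} [MeasurableSpace Ω] [MeasurableSpace α] [MeasurableSpace β]
  {P : Measure Ω} [IsProbabilityMeasure P] {A : Ω → α} {R : Ω → β}

lemma lintegral_comp_of_indepFun (hA : AEMeasurable A P) (hR : AEMeasurable R P)
    (hind : IndepFun A R P) {f : α × β → ENNReal} (hf : Measurable f) :
    ∫⁻ o, f (A o, R o) ∂P = ∫⁻ a, ∫⁻ o, f (a, R o) ∂P ∂(P.map A) := by
  have : IsProbabilityMeasure (P.map R) := Measure.isProbabilityMeasure_map hR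
  rw [← lintegral_map' (f := f) (g := fun o => (A o, R o)) hf.aemeasurable (hA.prodMk hR),
    (indepFun_iff_map_prod_eq_prod_map_map hA hR).1 hind, lintegral_prod _ hf.aemeasurable]
  refine lintegral_congr fun a => ?_
  exact lintegral_map' (f := fun y => f (a, y)) (by fun_prop) hR

/-- By Fubini for the product law, a bound that is uniform in the frozen value of `A` survives
integration over `A`. -/
lemma measure_le_of_indepFun (hA : AEMeasurable A P) (hR : AEMeasurable R P)
    (hind : IndepFun A R P) {s : Set (α × β)} (hs : MeasurableSet s) {c : ENNReal}
    (hc : ∀ a, P {o | (a, R o) ∈ s} ≤ c) : P {o | (A o, R o) ∈ s} ≤ c := by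
  have : IsProbabilityMeasure (P.map R) := Measure.isProbabilityMeasure_map hR
  have : IsProbabilityMeasure (P.map A) := Measure.isProbabilityMeasure_map hA
  have e : P {o | (A o, R o) ∈ s} = P.map (fun o => (A o, R o)) s := by
    rw [Measure.map_apply_of_aemeasurable (hA.prodMk hR) hs]
    rfl
  rw [e, (indepFun_iff_map_prod_eq_prod_map_map hA hR).1 hind, Measure.prod_apply hs]
  calc ∫⁻ a, P.map R (Prod.mk a ⁻¹' s) ∂(P.map A)
      ≤ ∫⁻ _, c ∂(P.map A) := by
        refine lintegral_mono fun a => ?_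
        rw [Measure.map_apply_of_aemeasurable hR (measurable_prodMk_left hs)]
        exact hc a
    _ = c := by simp

end Indep

/-! ### Gaussian samples: mean, residuals and empirical variances -/

section Sample

variable {d n : ℕ}

/-- The empirical mean of a sample. -/
def sampleMean (y : Fin n → EuclideanSpace ℝ (Fin d)) : EuclideanSpace ℝ (Fin d) :=
  (n : ℝ)⁻¹ • ∑ i, y i

/-- The residuals of a sample. -/
def residual (y : Fin n → EuclideanSpace ℝ (Fin d)) (i : Fin n) : EuclideanSpace ℝ (Fin d) :=
  y i - sampleMean y

/-- The normalised sum of squares of the projections of `r` on `v`. -/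
def quadVar (r : Fin n → EuclideanSpace ℝ (Fin d)) (v : EuclideanSpace ℝ (Fin d)) : ℝ :=
  1 / ((n : ℝ) - 1) * ∑ i, inner ℝ v (r i) ^ 2

/-- The covariance operator of a covariance matrix. -/
abbrev covOp (S : Matrix (Fin d) (Fin d) ℝ) :
    EuclideanSpace ℝ (Fin d) →L[ℝ] EuclideanSpace ℝ (Fin d) :=
  Matrix.toEuclideanCLM (𝕜 := ℝ) S

lemma isPositive_covOp {S : Matrix (Fin d) (Fin d) ℝ} (hS : S.PosSemidef) :
    (covOp S).IsPositive := by
  rw [← ContinuousLinearMap.isPositive_toLinearMap_iff,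
    Matrix.coe_toEuclideanCLM_eq_toEuclideanLin, Matrix.isPositive_toEuclideanLin_iff]
  exact hS

lemma sum_inner_covOp (S : Matrix (Fin d) (Fin d) ℝ) :
    ∑ i, inner ℝ (EuclideanSpace.basisFun (Fin d) ℝ i)
      (covOp S (EuclideanSpace.basisFun (Fin d) ℝ i)) = S.trace := by
  simp [Matrix.trace, Matrix.inner_toEuclideanCLM]

@[fun_prop]
lemma continuous_sampleMean :
    Continuous (sampleMean : (Fin n → EuclideanSpace ℝ (Fin d)) → _) := by
  unfold sampleMean; fun_prop

@[fun_prop]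
lemma continuous_residual :
    Continuous (residual : (Fin n → EuclideanSpace ℝ (Fin d)) → _) := by
  unfold residual; fun_prop

lemma continuous_quadVar {α : Type*} [TopologicalSpace α]
    {f : α → Fin n → EuclideanSpace ℝ (Fin d)} {g : α → EuclideanSpace ℝ (Fin d)}
    (hf : Continuous f) (hg : Continuous g) : Continuous fun a => quadVar (f a) (g a) := by
  have : ∀ i, Continuous fun a => f a i := fun i => (continuous_apply i).comp hf
  unfold quadVar
  fun_prop

lemma aemeasurable_quadVar {α : Type*} [MeasurableSpace α] {Q : Measure α}
    {f : α → Fin n → EuclideanSpace ℝ (Fin d)} {g : α → EuclideanSpace ℝ (Fin d)}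
    (hf : AEMeasurable f Q) (hg : AEMeasurable g Q) :
    AEMeasurable (fun a => quadVar (f a) (g a)) Q := by
  have : ∀ i, AEMeasurable (fun a => f a i) Q := fun i =>
    (measurable_pi_apply i).comp_aemeasurable hf
  unfold quadVar
  fun_prop

lemma quadVar_nonneg (hn : 1 < n) (r : Fin n → EuclideanSpace ℝ (Fin d))
    (v : EuclideanSpace ℝ (Fin d)) : 0 ≤ quadVar r v := by
  have : (1 : ℝ) < n := by exact_mod_cast hn
  exact mul_nonneg (one_div_nonneg.2 (by linarith)) (Finset.sum_nonneg fun i _ => sq_nonneg _)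

/-- Exhibits `√(quadVar r ·)` as a seminorm of the direction, whence the triangle inequality below.
-/
lemma sqrt_quadVar_eq_norm (r : Fin n → EuclideanSpace ℝ (Fin d))
    (v : EuclideanSpace ℝ (Fin d)) :
    √(quadVar r v) = √(1 / ((n : ℝ) - 1)) * ‖WithLp.toLp 2 fun i => inner ℝ v (r i)‖ := by
  rw [quadVar, Real.sqrt_mul' _ (Finset.sum_nonneg fun i _ => sq_nonneg _),
    EuclideanSpace.norm_eq]
  simp

lemma sqrt_quadVar_sub_le (r : Fin n → EuclideanSpace ℝ (Fin d))
    (v w : EuclideanSpace ℝ (Fin d)) :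
    √(quadVar r (v - w)) ≤ √(quadVar r v) + √(quadVar r w) := by
  simp_rw [sqrt_quadVar_eq_norm, ← mul_add]
  gcongr
  refine le_of_eq_of_le ?_ (norm_sub_le _ _)
  congr 1
  ext i
  simp [inner_sub_left]

variable {Ω : Type*} [MeasurableSpace Ω] {P : Measure Ω}

/-- `X` is an i.i.d. sample from the Gaussian law with mean `m` and covariance matrix `S`. -/
structure IsGaussianSample (P : Measure Ω) (X : Ω → Fin n → EuclideanSpace ℝ (Fin d))
    (m : EuclideanSpace ℝ (Fin d)) (S : Matrix (Fin d) (Fin d) ℝ) : Prop where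
  posSemidef : S.PosSemidef
  hasLaw : ∀ i, HasLaw (fun o => X o i) (multivariateGaussian m S) P
  indep : iIndepFun (fun i o => X o i) P

namespace IsGaussianSample

variable {X : Ω → Fin n → EuclideanSpace ℝ (Fin d)} {m : EuclideanSpace ℝ (Fin d)}
  {S : Matrix (Fin d) (Fin d) ℝ}

lemma aemeasurable (h : IsGaussianSample P X m S) : AEMeasurable X P :=
  aemeasurable_pi_lambda _ fun i => (h.hasLaw i).aemeasurable

lemma hasGaussianLaw (h : IsGaussianSample P X m S) : HasGaussianLaw X P :=
  h.indep.hasGaussianLaw fun i => (h.hasLaw i).hasGaussianLaw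

lemma memLp_inner (h : IsGaussianSample P X m S) (v : EuclideanSpace ℝ (Fin d)) (i : Fin n) :
    MemLp (fun o => inner ℝ v (X o i)) 2 P :=
  ((h.hasLaw i).hasGaussianLaw.map_fun (innerSL ℝ v)).memLp_two

lemma integral_inner (h : IsGaussianSample P X m S) (v : EuclideanSpace ℝ (Fin d)) (i : Fin n) :
    ∫ o, inner ℝ v (X o i) ∂P = inner ℝ v m := by
  have h1 := (h.hasLaw i).integral_eq
  rw [integral_id_multivariateGaussian] at h1
  rw [_root_.integral_inner (h.hasLaw i).hasGaussianLaw.integrable, h1]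

lemma covariance_inner (h : IsGaussianSample P X m S) (v w : EuclideanSpace ℝ (Fin d))
    (i j : Fin n) :
    cov[fun o => inner ℝ v (X o i), fun o => inner ℝ w (X o j); P]
      = if i = j then inner ℝ v (covOp S w) else 0 := by
  split_ifs with hij
  · subst hij
    rw [(h.hasLaw i).covariance_fun_comp (f := fun x => inner ℝ v x) (g := fun x => inner ℝ w x)
      (by fun_prop) (by fun_prop), ← covarianceBilin_apply_eq_cov IsGaussian.memLp_two_id,
      covarianceBilin_multivariateGaussian h.posSemidef, Matrix.inner_toEuclideanCLM]
  · exact IndepFun.covariance_eq_zero ((h.indep.indepFun hij).comp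
      (φ := fun x => inner ℝ v x) (ψ := fun x => inner ℝ w x) (by fun_prop) (by fun_prop))
      (h.memLp_inner v i) (h.memLp_inner w j)

lemma inner_sampleMean (v : EuclideanSpace ℝ (Fin d)) (y : Fin n → EuclideanSpace ℝ (Fin d)) :
    inner ℝ v (sampleMean y) = (n : ℝ)⁻¹ * ∑ i, inner ℝ v (y i) := by
  rw [sampleMean, real_inner_smul_right, inner_sum]

lemma memLp_inner_sampleMean (h : IsGaussianSample P X m S) (v : EuclideanSpace ℝ (Fin d)) :
    MemLp (fun o => inner ℝ v (sampleMean (X o))) 2 P := by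
  simp_rw [inner_sampleMean]
  exact (memLp_finsetSum _ fun i _ => h.memLp_inner v i).const_mul _

lemma isCenteredGaussian_sub (h : IsGaussianSample P X m S) (i : Fin n) :
    IsCenteredGaussian P (fun o => X o i - m) 1 (covOp S) := by
  intro v
  have hg := (h.hasLaw i).hasGaussianLaw.map_fun (innerSL ℝ v)
  have h1 : HasLaw (fun o => inner ℝ v (X o i))
      (gaussianReal (inner ℝ v m) (inner ℝ v (covOp S v)).toNNReal) P := by
    refine ⟨hg.aemeasurable, ?_⟩
    have := hg.map_eq_gaussianReal
    simp only [innerSL_apply_apply] at this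
    change P.map (fun o => inner ℝ v (X o i)) = _
    rw [this, h.integral_inner, ← covariance_self (h.memLp_inner v i).aemeasurable]
    rw [h.covariance_inner, if_pos rfl]
  simpa [inner_sub_right] using gaussianReal_sub_const h1 (inner ℝ v m)

variable [IsProbabilityMeasure P]

lemma covariance_inner_sampleMean_left (h : IsGaussianSample P X m S)
    (v w : EuclideanSpace ℝ (Fin d)) (j : Fin n) :
    cov[fun o => inner ℝ v (sampleMean (X o)), fun o => inner ℝ w (X o j); P]
      = (n : ℝ)⁻¹ * inner ℝ v (covOp S w) := by
  simp_rw [inner_sampleMean]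
  rw [covariance_const_mul_left,
    covariance_fun_sum_left (fun i => h.memLp_inner v i) (h.memLp_inner w j)]
  simp_rw [h.covariance_inner]
  simp

lemma covariance_inner_sampleMean (h : IsGaussianSample P X m S) (hn : n ≠ 0)
    (v w : EuclideanSpace ℝ (Fin d)) :
    cov[fun o => inner ℝ v (sampleMean (X o)), fun o => inner ℝ w (sampleMean (X o)); P]
      = (n : ℝ)⁻¹ * inner ℝ v (covOp S w) := by
  simp_rw [inner_sampleMean w]
  rw [covariance_const_mul_right,
    covariance_fun_sum_right (fun i => h.memLp_inner w i) (h.memLp_inner_sampleMean v)]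
  simp_rw [h.covariance_inner_sampleMean_left]
  have : (n : ℝ) ≠ 0 := by exact_mod_cast hn
  simp [this]

lemma isCenteredGaussian_sampleMean_sub (h : IsGaussianSample P X m S) (hn : n ≠ 0) :
    IsCenteredGaussian P (fun o => sampleMean (X o) - m) (n : ℝ)⁻¹ (covOp S) := by
  intro v
  have hn' : (n : ℝ) ≠ 0 := by exact_mod_cast hn
  have hg : HasGaussianLaw (fun o => inner ℝ v (sampleMean (X o))) P := by
    have := h.hasGaussianLaw.map_fun
      ((innerSL ℝ v).comp ((n : ℝ)⁻¹ • ∑ i : Fin n, ContinuousLinearMap.proj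
        (R := ℝ) (φ := fun _ : Fin n => EuclideanSpace ℝ (Fin d)) i))
    refine this.congr (Filter.Eventually.of_forall fun o => ?_)
    simp [inner_sampleMean]
  have hm : ∫ o, inner ℝ v (sampleMean (X o)) ∂P = inner ℝ v m := by
    simp_rw [inner_sampleMean]
    rw [integral_const_mul, integral_finsetSum _ fun i _ =>
      (h.memLp_inner v i).integrable (by norm_num)]
    simp_rw [h.integral_inner]
    simp [hn']
  have h1 : HasLaw (fun o => inner ℝ v (sampleMean (X o)))
      (gaussianReal (inner ℝ v m) ((n : ℝ)⁻¹ * inner ℝ v (covOp S v)).toNNReal) P := by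
    refine ⟨hg.aemeasurable, ?_⟩
    rw [hg.map_eq_gaussianReal, hm, ← covariance_self hg.aemeasurable,
      h.covariance_inner_sampleMean hn]
  simpa [inner_sub_right] using gaussianReal_sub_const h1 (inner ℝ v m)

/-- Mean and residuals are linear images of one Gaussian vector, so independence amounts to
vanishing covariances. -/
lemma indepFun_sampleMean_residual (h : IsGaussianSample P X m S) (hn : n ≠ 0) :
    IndepFun (fun o => sampleMean (X o)) (fun o => residual (X o)) P := by
  set mean : (Fin n → EuclideanSpace ℝ (Fin d)) →L[ℝ] EuclideanSpace ℝ (Fin d) :=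
    (n : ℝ)⁻¹ • ∑ i : Fin n, ContinuousLinearMap.proj (R := ℝ)
      (φ := fun _ : Fin n => EuclideanSpace ℝ (Fin d)) i with hmean
  have hmean_apply : ∀ y, mean y = sampleMean y := fun y => by simp [hmean, sampleMean]
  set F : Unit ⊕ Fin n → (Fin n → EuclideanSpace ℝ (Fin d)) →L[ℝ] EuclideanSpace ℝ (Fin d) :=
    Sum.elim (fun _ => mean) (fun i => ContinuousLinearMap.proj (R := ℝ)
      (φ := fun _ : Fin n => EuclideanSpace ℝ (Fin d)) i - mean) with hF
  have hproc : IsGaussianProcess (Sum.elim (fun (_ : Unit) o => sampleMean (X o))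
      (fun i o => residual (X o) i)) P := by
    refine ⟨fun I => ?_⟩
    have := h.hasGaussianLaw.map_fun (ContinuousLinearMap.pi fun s : I => F s)
    refine this.congr (Filter.Eventually.of_forall fun o => ?_)
    funext s
    obtain ⟨s, hs⟩ := s
    rcases s with s | s
    · simp [hF, hmean_apply]
    · simp [hF, hmean_apply, residual]
  have hX := h.aemeasurable
  have hr : ∀ i, AEMeasurable (fun o => residual (X o) i) P := fun i =>
    ((continuous_apply i).comp continuous_residual).measurable.comp_aemeasurable hX
  have hmn : AEMeasurable (fun o => sampleMean (X o)) P :=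
    continuous_sampleMean.measurable.comp_aemeasurable hX
  -- The mean has the same covariance, `n⁻¹` times that of one observation, with each observation as
  -- with itself; the difference is zero.
  have hind := hproc.indepFun_of_covariance_inner (fun _ => hmn) hr (by
    intro _ i x y
    simp_rw [residual, inner_sub_right]
    rw [covariance_fun_sub_right (h.memLp_inner_sampleMean x) (h.memLp_inner y i)
      (h.memLp_inner_sampleMean y), h.covariance_inner_sampleMean_left,
      h.covariance_inner_sampleMean hn, sub_self])
  exact hind.comp (φ := fun f => f ()) (ψ := fun f => f)
    (measurable_pi_apply (X := fun _ : Unit => EuclideanSpace ℝ (Fin d)) ()) measurable_id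

lemma memLp_inner_residual (h : IsGaussianSample P X m S) (v : EuclideanSpace ℝ (Fin d))
    (i : Fin n) : MemLp (fun o => inner ℝ v (residual (X o) i)) 2 P := by
  simp_rw [residual, inner_sub_right]
  exact (h.memLp_inner v i).sub (h.memLp_inner_sampleMean v)

lemma integral_inner_residual_sq (h : IsGaussianSample P X m S) (hn : n ≠ 0)
    (v : EuclideanSpace ℝ (Fin d)) (i : Fin n) :
    ∫ o, inner ℝ v (residual (X o) i) ^ 2 ∂P
      = (1 - (n : ℝ)⁻¹) * inner ℝ v (covOp S v) := by
  have hL := h.memLp_inner_residual v i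
  have h0 : ∫ o, inner ℝ v (residual (X o) i) ∂P = 0 := by
    have h1 := (h.isCenteredGaussian_sampleMean_sub hn).integral_inner v
    have h2 := (h.isCenteredGaussian_sub i).integral_inner v
    have e : ∀ o, inner ℝ v (residual (X o) i)
        = inner ℝ v (X o i - m) - inner ℝ v (sampleMean (X o) - m) := fun o => by
      rw [← inner_sub_right, residual]; congr 1; abel
    simp_rw [e]
    rw [integral_sub, h1, h2, sub_zero]
    · simpa using (h.isCenteredGaussian_sub i).integrable_pow v 1
    · simpa using (h.isCenteredGaussian_sampleMean_sub hn).integrable_pow v 1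
  rw [← variance_of_integral_eq_zero hL.aemeasurable h0, ← covariance_self hL.aemeasurable]
  simp_rw [residual, inner_sub_right]
  have hA := h.memLp_inner v i
  have hB := h.memLp_inner_sampleMean v
  rw [covariance_fun_sub_fun_sub hA hB hA hB, h.covariance_inner, if_pos rfl,
    covariance_comm (fun o => inner ℝ v (X o i)), h.covariance_inner_sampleMean_left,
    h.covariance_inner_sampleMean hn]
  ring

lemma integrable_quadVar_residual (h : IsGaussianSample P X m S)
    (v : EuclideanSpace ℝ (Fin d)) :
    Integrable (fun o => quadVar (residual (X o)) v) P :=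
  (integrable_finsetSum _ fun i _ => (h.memLp_inner_residual v i).integrable_sq).const_mul _

lemma integral_quadVar_residual (h : IsGaussianSample P X m S) (hn : 1 < n)
    (v : EuclideanSpace ℝ (Fin d)) :
    ∫ o, quadVar (residual (X o)) v ∂P = inner ℝ v (covOp S v) := by
  have hn' : (1 : ℝ) < n := by exact_mod_cast hn
  have hn0 : (n : ℝ) - 1 ≠ 0 := by linarith
  have hn1 : (n : ℝ) ≠ 0 := by linarith
  simp_rw [quadVar]
  rw [integral_const_mul, integral_finsetSum _ fun i _ =>
    (h.memLp_inner_residual v i).integrable_sq]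
  simp_rw [h.integral_inner_residual_sq (by omega)]
  simp only [Finset.sum_const, Finset.card_univ, Fintype.card_fin, nsmul_eq_mul]
  field_simp

/-- The empirical variance in a random direction that is independent of the residuals. -/
lemma lintegral_quadVar_le (h : IsGaussianSample P X m S) (hn : 1 < n)
    {A : Ω → EuclideanSpace ℝ (Fin d)} (hA : AEMeasurable A P)
    (hind : IndepFun A (fun o => residual (X o)) P)
    (hA2 : Integrable (fun o => ‖A o‖ ^ 2) P) :
    ∫⁻ o, ENNReal.ofReal (quadVar (residual (X o)) (A o)) ∂P
      ≤ ENNReal.ofReal (‖covOp S‖ * ∫ o, ‖A o‖ ^ 2 ∂P) := by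
  have hR : AEMeasurable (fun o => residual (X o)) P :=
    continuous_residual.measurable.comp_aemeasurable h.aemeasurable
  have hq : Measurable (fun p : EuclideanSpace ℝ (Fin d) × (Fin n → EuclideanSpace ℝ (Fin d)) =>
      ENNReal.ofReal (quadVar p.2 p.1)) :=
    (continuous_quadVar continuous_snd continuous_fst).measurable.ennreal_ofReal
  have key : ∀ a, ∫⁻ o, ENNReal.ofReal (quadVar (residual (X o)) a) ∂P
      ≤ ENNReal.ofReal (‖covOp S‖ * ‖a‖ ^ 2) := by
    intro a
    rw [← ofReal_integral_eq_lintegral_ofReal (h.integrable_quadVar_residual a)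
      (Filter.Eventually.of_forall fun o => quadVar_nonneg hn _ _), h.integral_quadVar_residual hn]
    exact ENNReal.ofReal_le_ofReal (inner_apply_le_of_isPositive a)
  rw [lintegral_comp_of_indepFun hA hR hind hq]
  refine (lintegral_mono key).trans (le_of_eq ?_)
  rw [lintegral_map' (Measurable.aemeasurable (by fun_prop)) hA, ← integral_const_mul,
    ofReal_integral_eq_lintegral_ofReal (hA2.const_mul _)
      (Filter.Eventually.of_forall fun o => mul_nonneg (norm_nonneg _) (sq_nonneg _))]

lemma integrable_quadVar (h : IsGaussianSample P X m S) (hn : 1 < n)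
    {A : Ω → EuclideanSpace ℝ (Fin d)} (hA : AEMeasurable A P)
    (hind : IndepFun A (fun o => residual (X o)) P)
    (hA2 : Integrable (fun o => ‖A o‖ ^ 2) P) :
    Integrable (fun o => quadVar (residual (X o)) (A o)) P := by
  have hR : AEMeasurable (fun o => residual (X o)) P :=
    continuous_residual.measurable.comp_aemeasurable h.aemeasurable
  refine ⟨(aemeasurable_quadVar hR hA).aestronglyMeasurable, ?_⟩
  rw [hasFiniteIntegral_iff_ofReal (Filter.Eventually.of_forall fun o => quadVar_nonneg hn _ _)]
  exact (h.lintegral_quadVar_le hn hA hind hA2).trans_lt ENNReal.ofReal_lt_top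

lemma integral_quadVar_le (h : IsGaussianSample P X m S) (hn : 1 < n)
    {A : Ω → EuclideanSpace ℝ (Fin d)} (hA : AEMeasurable A P)
    (hind : IndepFun A (fun o => residual (X o)) P)
    (hA2 : Integrable (fun o => ‖A o‖ ^ 2) P) :
    ∫ o, quadVar (residual (X o)) (A o) ∂P ≤ ‖covOp S‖ * ∫ o, ‖A o‖ ^ 2 ∂P := by
  rw [← ENNReal.ofReal_le_ofReal_iff (mul_nonneg (norm_nonneg _)
    (integral_nonneg fun o => by positivity)),
    ofReal_integral_eq_lintegral_ofReal (h.integrable_quadVar hn hA hind hA2)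
      (Filter.Eventually.of_forall fun o => quadVar_nonneg hn _ _)]
  exact h.lintegral_quadVar_le hn hA hind hA2

lemma integrable_sqrt {f : Ω → ℝ} (hf : Integrable f P) :
    Integrable (fun o => √(f o)) P := by
  refine ((integrable_const (1 : ℝ)).add hf.abs).mono'
    (Real.continuous_sqrt.comp_aestronglyMeasurable hf.aestronglyMeasurable)
    (Filter.Eventually.of_forall fun o => ?_)
  rw [Real.norm_of_nonneg (Real.sqrt_nonneg _)]
  refine Real.sqrt_le_iff.2 ⟨by simp only [Pi.add_apply]; positivity, ?_⟩
  simp only [Pi.add_apply]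
  nlinarith [abs_nonneg (f o), le_abs_self (f o)]

lemma integral_sqrt_le {f : Ω → ℝ} (hf : Integrable f P) (h0 : ∀ o, 0 ≤ f o) :
    ∫ o, √(f o) ∂P ≤ √(∫ o, f o ∂P) := by
  have h1 : MemLp (fun o => √(f o)) 2 P := by
    refine (memLp_two_iff_integrable_sq (integrable_sqrt hf).aestronglyMeasurable).2 ?_
    simpa [Real.sq_sqrt, h0] using hf
  have := integral_abs_le_sqrt_integral_sq h1
  simpa [Real.sq_sqrt, h0, abs_of_nonneg, Real.sqrt_nonneg] using this

/-- Freezing `A = a` makes `⟨a, X i - m⟩` an i.i.d. centred real Gaussian sample, to which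
`student_tail` applies with a bound free of `a`. The random direction therefore costs nothing. -/
lemma student_tail_of_indepFun (h : IsGaussianSample P X m S)
    {A : Ω → EuclideanSpace ℝ (Fin d)} (hA : AEMeasurable A P) (hind : IndepFun A X P)
    {u : ℝ} (hu : 0 < u) (hun : u ≤ ((n : ℝ) - 1) / 2) :
    P {o | 16 * √u * √(quadVar (residual (X o)) (A o) / n)
        < 2 * inner ℝ (A o) (sampleMean (X o) - m)}
      ≤ ENNReal.ofReal (√2 * Real.exp (-(3 / 2 * u))) := by
  have hX := h.aemeasurable
  have hn' : (n : ℝ) ≠ 0 := by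
    intro h0
    rw [h0] at hun
    linarith
  have hn : n ≠ 0 := by exact_mod_cast hn'
  set f : EuclideanSpace ℝ (Fin d) × (Fin n → EuclideanSpace ℝ (Fin d)) → ℝ :=
    fun p => 16 * √u * √(quadVar (residual p.2) p.1 / n) with hf
  set g : EuclideanSpace ℝ (Fin d) × (Fin n → EuclideanSpace ℝ (Fin d)) → ℝ :=
    fun p => 2 * inner ℝ p.1 (sampleMean p.2 - m) with hg
  have hfm : Measurable f := by
    have h1 : Continuous fun p : EuclideanSpace ℝ (Fin d) × (Fin n → EuclideanSpace ℝ (Fin d)) =>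
        quadVar (residual p.2) p.1 :=
      continuous_quadVar (continuous_residual.comp continuous_snd) continuous_fst
    exact ((Real.continuous_sqrt.comp (h1.div_const _)).const_mul _).measurable
  have hgm : Measurable g := by
    have h1 : Continuous fun p : EuclideanSpace ℝ (Fin d) × (Fin n → EuclideanSpace ℝ (Fin d)) =>
        inner ℝ p.1 (sampleMean p.2 - m) :=
      continuous_fst.inner ((continuous_sampleMean.comp continuous_snd).sub continuous_const)
    exact (continuous_const.mul h1).measurable
  have hBm : MeasurableSet {p | f p < g p} := measurableSet_lt hfm hgm
  have key : ∀ a, P {o | (a, X o) ∈ {p | f p < g p}} ≤ ENNReal.ofReal (√2 * Real.exp (-(3 / 2 * u))) := by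
    intro a
    have hY : iIndepFun (fun i o => inner ℝ a (X o i - m)) P :=
      h.indep.comp (fun _ x => inner ℝ a (x - m)) (fun _ => by fun_prop)
    have ht := student_tail (fun i => h.isCenteredGaussian_sub i a) hY hu hun
    have e1 : ∀ o, (n : ℝ)⁻¹ * ∑ j, inner ℝ a (X o j - m) = inner ℝ a (sampleMean (X o) - m) := by
      intro o
      simp_rw [inner_sub_right, inner_sampleMean, Finset.sum_sub_distrib, mul_sub]
      simp [hn']
    have e2 : ∀ o i, inner ℝ a (X o i - m) - inner ℝ a (sampleMean (X o) - m)
        = inner ℝ a (residual (X o) i) := fun o i => by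
      rw [← inner_sub_right, residual]; congr 1; abel
    simp_rw [e1, e2, ← Finset.sum_div] at ht
    simpa only [hf, hg, Set.mem_ofPred_eq, quadVar, mul_div_assoc] using ht
  have := measure_le_of_indepFun hA hX hind hBm key
  simpa only [hf, hg, Set.mem_ofPred_eq] using this

end IsGaussianSample

end Sample

/-! ### The risk estimate of a sample mean: unbiasedness and concentration -/

section SampleMoments

variable {d n : ℕ}

/-- The unbiased estimate of the risk of the empirical mean of a sample. -/
def meanRiskEst (y : Fin n → EuclideanSpace ℝ (Fin d)) : ℝ :=
  1 / ((n : ℝ) * ((n : ℝ) - 1)) * ∑ i, ‖y i - sampleMean y‖ ^ 2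

lemma meanRiskEst_nonneg (hn : 1 < n) (y : Fin n → EuclideanSpace ℝ (Fin d)) :
    0 ≤ meanRiskEst y := by
  have : (0 : ℝ) < (n : ℝ) - 1 := sub_pos.2 (by exact_mod_cast hn)
  unfold meanRiskEst
  positivity

/-- Recentring at the true mean leaves only squared norms of centred Gaussian vectors, whose means
and deviations are known. -/
lemma meanRiskEst_eq (hn : 1 < n) (y : Fin n → EuclideanSpace ℝ (Fin d))
    (m : EuclideanSpace ℝ (Fin d)) :
    meanRiskEst y = 1 / ((n : ℝ) - 1) *
      ((n : ℝ)⁻¹ * ∑ i, ‖y i - m‖ ^ 2 - ‖sampleMean y - m‖ ^ 2) := by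
  have h1 : (1 : ℝ) < n := by exact_mod_cast hn
  have hn0 : (n : ℝ) ≠ 0 := by linarith
  have e : ∀ i, ‖y i - sampleMean y‖ ^ 2
      = ‖y i - m‖ ^ 2 - 2 * inner ℝ (y i - m) (sampleMean y - m) + ‖sampleMean y - m‖ ^ 2 := by
    intro i
    rw [← norm_sub_sq_real]
    congr 2; abel
  have hs : ∑ i, (y i - m) = (n : ℝ) • (sampleMean y - m) := by
    rw [smul_sub, sampleMean, smul_inv_smul₀ hn0, Finset.sum_sub_distrib]
    simp [Nat.cast_smul_eq_nsmul ℝ]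
  have hc : ∑ i, inner ℝ (y i - m) (sampleMean y - m) = n * ‖sampleMean y - m‖ ^ 2 := by
    rw [← sum_inner, hs, real_inner_smul_left, real_inner_self_eq_norm_sq]
  unfold meanRiskEst
  simp_rw [e, Finset.sum_add_distrib, Finset.sum_sub_distrib, ← Finset.mul_sum]
  rw [hc]
  simp only [Finset.sum_const, Finset.card_univ, Fintype.card_fin, nsmul_eq_mul]
  field_simp
  ring

namespace IsGaussianSample

variable {Ω : Type*} [MeasurableSpace Ω] {P : Measure Ω} [IsProbabilityMeasure P]
  {X : Ω → Fin n → EuclideanSpace ℝ (Fin d)} {m : EuclideanSpace ℝ (Fin d)}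
  {S : Matrix (Fin d) (Fin d) ℝ}

lemma integrable_norm_sub_sq (h : IsGaussianSample P X m S) (i : Fin n) :
    Integrable (fun o => ‖X o i - m‖ ^ 2) P :=
  (h.isCenteredGaussian_sub i).integrable_norm_sq (EuclideanSpace.basisFun _ _)

lemma integrable_norm_sampleMean_sub_sq (h : IsGaussianSample P X m S) (hn : n ≠ 0) :
    Integrable (fun o => ‖sampleMean (X o) - m‖ ^ 2) P :=
  (h.isCenteredGaussian_sampleMean_sub hn).integrable_norm_sq (EuclideanSpace.basisFun _ _)

lemma integral_norm_sub_sq (h : IsGaussianSample P X m S) (i : Fin n) :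
    ∫ o, ‖X o i - m‖ ^ 2 ∂P = S.trace := by
  rw [(h.isCenteredGaussian_sub i).integral_norm_sq (EuclideanSpace.basisFun _ _) zero_le_one
    (isPositive_covOp h.posSemidef), sum_inner_covOp, one_mul]

lemma integral_norm_sampleMean_sub_sq (h : IsGaussianSample P X m S) (hn : n ≠ 0) :
    ∫ o, ‖sampleMean (X o) - m‖ ^ 2 ∂P = S.trace / n := by
  rw [(h.isCenteredGaussian_sampleMean_sub hn).integral_norm_sq (EuclideanSpace.basisFun _ _)
    (by positivity) (isPositive_covOp h.posSemidef), sum_inner_covOp, inv_mul_eq_div]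

lemma integral_abs_norm_sub_sq_le (h : IsGaussianSample P X m S) (i : Fin n) :
    ∫ o, |‖X o i - m‖ ^ 2 - S.trace| ∂P ≤ √2 * √(‖covOp S‖ * S.trace) := by
  have := (h.isCenteredGaussian_sub i).integral_abs_norm_sq_sub_le
    (EuclideanSpace.basisFun _ _) zero_le_one (isPositive_covOp h.posSemidef)
  simpa only [sum_inner_covOp, one_mul] using this

lemma integral_abs_norm_sampleMean_sub_sq_le (h : IsGaussianSample P X m S) (hn : n ≠ 0) :
    ∫ o, |‖sampleMean (X o) - m‖ ^ 2 - S.trace / n| ∂P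
      ≤ √2 * (√(‖covOp S‖ * S.trace) / n) := by
  have := (h.isCenteredGaussian_sampleMean_sub hn).integral_abs_norm_sq_sub_le
    (EuclideanSpace.basisFun _ _) (by positivity) (isPositive_covOp h.posSemidef)
  simpa only [sum_inner_covOp, inv_mul_eq_div] using this

lemma integrable_meanRiskEst (h : IsGaussianSample P X m S) (hn : 1 < n) :
    Integrable (fun o => meanRiskEst (X o)) P := by
  simp_rw [meanRiskEst_eq hn _ m]
  exact (((integrable_finsetSum _ fun i _ => h.integrable_norm_sub_sq i).const_mul _).sub
    (h.integrable_norm_sampleMean_sub_sq (by omega))).const_mul _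

lemma integral_meanRiskEst (h : IsGaussianSample P X m S) (hn : 1 < n) :
    ∫ o, meanRiskEst (X o) ∂P = S.trace / n := by
  have h1 : (0 : ℝ) < (n : ℝ) - 1 := sub_pos.2 (by exact_mod_cast hn)
  have hn0 : (n : ℝ) ≠ 0 := by linarith
  simp_rw [meanRiskEst_eq hn _ m]
  rw [integral_const_mul, integral_sub
    ((integrable_finsetSum _ fun i _ => h.integrable_norm_sub_sq i).const_mul _)
    (h.integrable_norm_sampleMean_sub_sq (by omega)), integral_const_mul,
    integral_finsetSum _ fun i _ => h.integrable_norm_sub_sq i,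
    h.integral_norm_sampleMean_sub_sq (by omega)]
  simp_rw [h.integral_norm_sub_sq]
  simp only [Finset.sum_const, Finset.card_univ, Fintype.card_fin, nsmul_eq_mul]
  field_simp

lemma integral_abs_meanRiskEst_sub_le (h : IsGaussianSample P X m S) (hn : 1 < n) :
    ∫ o, |meanRiskEst (X o) - S.trace / n| ∂P
      ≤ 3 * √2 * (√(‖covOp S‖ * S.trace) / n) := by
  have h2 : (2 : ℝ) ≤ n := by exact_mod_cast hn
  have h1 : (0 : ℝ) < (n : ℝ) - 1 := by linarith
  have hn0 : (0 : ℝ) < n := by linarith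
  set ρ := √(‖covOp S‖ * S.trace) with hρ
  have hρ0 : 0 ≤ ρ := Real.sqrt_nonneg _
  have i1 : ∀ i, Integrable (fun o => |‖X o i - m‖ ^ 2 - S.trace|) P := fun i =>
    ((h.integrable_norm_sub_sq i).sub (integrable_const _)).abs
  have i2 : Integrable (fun o => |‖sampleMean (X o) - m‖ ^ 2 - S.trace / n|) P :=
    ((h.integrable_norm_sampleMean_sub_sq (by omega)).sub (integrable_const _)).abs
  have i3 : Integrable (fun o => ∑ i, |‖X o i - m‖ ^ 2 - S.trace|) P :=
    integrable_finsetSum _ fun i _ => i1 i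
  have hpt : ∀ o, |meanRiskEst (X o) - S.trace / n| ≤ 1 / ((n : ℝ) - 1) *
      ((n : ℝ)⁻¹ * ∑ i, |‖X o i - m‖ ^ 2 - S.trace|
        + |‖sampleMean (X o) - m‖ ^ 2 - S.trace / n|) := by
    intro o
    have e : meanRiskEst (X o) - S.trace / n = 1 / ((n : ℝ) - 1) *
        ((n : ℝ)⁻¹ * ∑ i, (‖X o i - m‖ ^ 2 - S.trace)
          - (‖sampleMean (X o) - m‖ ^ 2 - S.trace / n)) := by
      rw [meanRiskEst_eq hn _ m, Finset.sum_sub_distrib]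
      simp only [Finset.sum_const, Finset.card_univ, Fintype.card_fin, nsmul_eq_mul]
      field_simp
      ring
    rw [e, abs_mul, abs_of_pos (by positivity : 0 < 1 / ((n : ℝ) - 1))]
    gcongr
    refine (abs_sub _ _).trans ?_
    rw [abs_mul, abs_of_pos (by positivity : 0 < (n : ℝ)⁻¹)]
    gcongr
    exact Finset.abs_sum_le_sum_abs _ _
  have hint := ((i3.const_mul (n : ℝ)⁻¹).add i2).const_mul (1 / ((n : ℝ) - 1))
  calc ∫ o, |meanRiskEst (X o) - S.trace / n| ∂P
      ≤ ∫ o, 1 / ((n : ℝ) - 1) * ((n : ℝ)⁻¹ * ∑ i, |‖X o i - m‖ ^ 2 - S.trace|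
        + |‖sampleMean (X o) - m‖ ^ 2 - S.trace / n|) ∂P :=
        integral_mono ((h.integrable_meanRiskEst hn).sub (integrable_const _)).abs hint hpt
    _ = 1 / ((n : ℝ) - 1) * ((n : ℝ)⁻¹ * ∑ i, ∫ o, |‖X o i - m‖ ^ 2 - S.trace| ∂P
        + ∫ o, |‖sampleMean (X o) - m‖ ^ 2 - S.trace / n| ∂P) := by
        rw [integral_const_mul, integral_add (i3.const_mul _) i2, integral_const_mul,
          integral_finsetSum _ fun i _ => i1 i]
    _ ≤ 1 / ((n : ℝ) - 1) * ((n : ℝ)⁻¹ * ∑ _i : Fin n, √2 * ρ + √2 * (ρ / n)) := by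
        gcongr
        · exact h.integral_abs_norm_sub_sq_le _
        · exact h.integral_abs_norm_sampleMean_sub_sq_le (by omega)
    -- The left side is `(n + 1) / (n - 1)` times `√2 * (ρ / n)`, and that factor is at most 3 for
    -- `n ≥ 2`.
    _ ≤ 3 * √2 * (ρ / n) := by
        simp only [Finset.sum_const, Finset.card_univ, Fintype.card_fin, nsmul_eq_mul]
        rw [inv_mul_cancel_left₀ hn0.ne', div_mul_eq_mul_div, one_mul, div_le_iff₀ h1]
        have e : √2 * ρ = n * (√2 * (ρ / n)) := by field_simp
        have h0 : 0 ≤ √2 * (ρ / n) := by positivity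
        rw [e]
        nlinarith

lemma indepFun_sampleMean_sub_residual (h : IsGaussianSample P X m S) (hn : n ≠ 0) :
    IndepFun (fun o => sampleMean (X o) - m) (fun o => residual (X o)) P :=
  (h.indepFun_sampleMean_residual hn).comp (φ := fun z => z - m) (ψ := fun r => r)
    (measurable_sub_const m) measurable_id

lemma integrable_sqrt_quadVar_div (h : IsGaussianSample P X m S) (hn : 1 < n)
    {A : Ω → EuclideanSpace ℝ (Fin d)} (hA : AEMeasurable A P)
    (hind : IndepFun A (fun o => residual (X o)) P)
    (hA2 : Integrable (fun o => ‖A o‖ ^ 2) P) :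
    Integrable (fun o => √(quadVar (residual (X o)) (A o) / n)) P :=
  integrable_sqrt ((h.integrable_quadVar hn hA hind hA2).div_const _)

lemma integral_sqrt_quadVar_div_le (h : IsGaussianSample P X m S) (hn : 1 < n)
    {A : Ω → EuclideanSpace ℝ (Fin d)} (hA : AEMeasurable A P)
    (hind : IndepFun A (fun o => residual (X o)) P)
    (hA2 : Integrable (fun o => ‖A o‖ ^ 2) P) :
    ∫ o, √(quadVar (residual (X o)) (A o) / n) ∂P
      ≤ √(‖covOp S‖ / n) * √(∫ o, ‖A o‖ ^ 2 ∂P) := by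
  have hi := (h.integrable_quadVar hn hA hind hA2).div_const (n : ℝ)
  refine (integral_sqrt_le hi fun o =>
    div_nonneg (quadVar_nonneg hn _ _) (Nat.cast_nonneg _)).trans ?_
  rw [← Real.sqrt_mul (by positivity)]
  apply Real.sqrt_le_sqrt
  rw [integral_div, div_mul_eq_mul_div]
  gcongr
  exact h.integral_quadVar_le hn hA hind hA2

end IsGaussianSample

end SampleMoments

/-! ### Pathwise comparison of the loss and the objective -/

section Pathwise

variable {d B : ℕ} {N : Fin B → ℕ} {x : Bags d B N} {k : Fin B} {w w' : Fin B → ℝ}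
  {m : EuclideanSpace ℝ (Fin d)} {u : ℝ}

lemma qEst_eq_quadVar (x : Bags d B N) (k l : Fin B) :
    qEst x k l = quadVar (residual (x k)) (naiveMean x k - naiveMean x l) :=
  rfl

lemma sum_erase_eq_one_sub (hw : w ∈ stdSimplex ℝ (Fin B)) (k : Fin B) :
    ∑ l ∈ Finset.univ.erase k, w l = 1 - w k := by
  rw [← hw.2, ← Finset.add_sum_erase _ _ (Finset.mem_univ k)]
  ring

lemma aggregate_sub_eq (hw : w ∈ stdSimplex ℝ (Fin B)) :
    aggregate x w - m = ∑ l ∈ Finset.univ.erase k, w l • (naiveMean x l - naiveMean x k)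
      + (naiveMean x k - m) := by
  have h1 : ∑ l ∈ Finset.univ.erase k, w l • (naiveMean x l - naiveMean x k)
      = ∑ l, w l • (naiveMean x l - naiveMean x k) := by
    rw [← Finset.add_sum_erase _ _ (Finset.mem_univ k)]
    simp
  rw [h1]
  simp_rw [smul_sub, Finset.sum_sub_distrib, ← Finset.sum_smul, hw.2, one_smul]
  rw [aggregate]
  abel

/-- The square is expanded around `μ̂_k`, and each `μ̂_l - μ̂_k` in the cross product is split at
`m`. The part along `μ̂_k - m` contributes `-2 (1 - w k) ‖μ̂_k - m‖²`, which with the square already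
present yields the coefficient `2 * w k - 1` used in `lossEst`. -/
lemma norm_aggregate_sub_sq_eq (hw : w ∈ stdSimplex ℝ (Fin B)) :
    ‖aggregate x w - m‖ ^ 2 = lossEst x k w
      + (2 * w k - 1) * (‖naiveMean x k - m‖ ^ 2 - naiveRiskEst x k)
      + 2 * ∑ l ∈ Finset.univ.erase k,
          w l * inner ℝ (naiveMean x l - m) (naiveMean x k - m) := by
  rw [aggregate_sub_eq (k := k) hw, norm_add_sq_real, lossEst, sum_inner]
  have e : ∀ l, inner ℝ (w l • (naiveMean x l - naiveMean x k)) (naiveMean x k - m)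
      = w l * inner ℝ (naiveMean x l - m) (naiveMean x k - m)
        - w l * ‖naiveMean x k - m‖ ^ 2 := by
    intro l
    rw [real_inner_smul_left, ← real_inner_self_eq_norm_sq, ← mul_sub, ← inner_sub_left]
    congr 2; abel
  simp_rw [e, Finset.sum_sub_distrib, ← Finset.sum_mul]
  rw [sum_erase_eq_one_sub hw]
  ring

lemma penaltyEst_nonneg (hw : w ∈ stdSimplex ℝ (Fin B)) : 0 ≤ penaltyEst x k w :=
  Finset.sum_nonneg fun l _ => mul_nonneg (hw.1 l) (Real.sqrt_nonneg _)

lemma sub_naiveRiskEst_le_objective (hN : 1 < N k) (hw : w ∈ stdSimplex ℝ (Fin B)) :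
    ‖∑ l ∈ Finset.univ.erase k, w l • (naiveMean x l - naiveMean x k)‖ ^ 2 - naiveRiskEst x k
      ≤ objective u x k w := by
  have h1 : 0 ≤ naiveRiskEst x k := meanRiskEst_nonneg hN _
  have h2 := penaltyEst_nonneg (x := x) (k := k) hw
  have h3 := mul_nonneg (hw.1 k) h1
  have h4 : 0 ≤ 16 * √u * penaltyEst x k w := by positivity
  rw [objective, lossEst]
  nlinarith

/-- Deterministic bound from the vertex at `k`, whose objective is `naiveRiskEst`. It yields
integrability of the loss and serves as the fallback on the bad event. -/
lemma IsQWeight.norm_aggregate_sub_sq_le (hN : 1 < N k) (hw : IsQWeight u x k w) :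
    ‖aggregate x w - m‖ ^ 2 ≤ 4 * naiveRiskEst x k + 2 * ‖naiveMean x k - m‖ ^ 2 := by
  classical
  have h1 : objective u x k (Pi.single k 1) = naiveRiskEst x k := by
    have h0 : ∀ l ∈ Finset.univ.erase k, (Pi.single k 1 : Fin B → ℝ) l = 0 := fun l hl =>
      Pi.single_eq_of_ne (Finset.ne_of_mem_erase hl) _
    rw [objective, lossEst, penaltyEst, Finset.sum_eq_zero fun l hl => by rw [h0 l hl, zero_smul],
      Finset.sum_eq_zero fun l hl => by rw [h0 l hl, zero_mul]]
    simp
    ring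
  have h2 := hw.2 (single_mem_stdSimplex ℝ k)
  simp only [Set.mem_ofPred_eq] at h2
  rw [h1] at h2
  have h3 := (sub_naiveRiskEst_le_objective (u := u) hN hw.1).trans h2
  rw [aggregate_sub_eq (k := k) hw.1]
  set v := ∑ l ∈ Finset.univ.erase k, w l • (naiveMean x l - naiveMean x k)
  have h4 := norm_add_sq_real v (naiveMean x k - m)
  have h5 := norm_sub_sq_real v (naiveMean x k - m)
  -- Parallelogram bound `‖v + e‖² ≤ 2 ‖v‖² + 2 ‖e‖²`, with `‖v‖² ≤ 2 * naiveRiskEst` from `h3`.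
  nlinarith [sq_nonneg ‖v - (naiveMean x k - m)‖]

/-- On the event where all cross terms are dominated by the penalty, the loss of a minimiser is
controlled by the objective at any competitor. -/
lemma IsQWeight.norm_aggregate_sub_sq_le_objective (hw : IsQWeight u x k w)
    (hw' : w' ∈ stdSimplex ℝ (Fin B))
    (hG : ∀ l ≠ k, 2 * inner ℝ (naiveMean x l - m) (naiveMean x k - m)
      ≤ 16 * √u * √(quadVar (residual (x k)) (naiveMean x l - m) / (N k : ℝ))) :
    ‖aggregate x w - m‖ ^ 2 ≤ objective u x k w'
      + |‖naiveMean x k - m‖ ^ 2 - naiveRiskEst x k|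
      + 16 * √u * √(quadVar (residual (x k)) (naiveMean x k - m) / (N k : ℝ)) := by
  have hmin : objective u x k w ≤ objective u x k w' := hw.2 hw'
  have hw1 := hw.1
  have hle1 : w k ≤ 1 := by
    have := sum_erase_eq_one_sub hw1 k
    have h0 : 0 ≤ ∑ l ∈ Finset.univ.erase k, w l := Finset.sum_nonneg fun l _ => hw1.1 l
    linarith
  set V := √(quadVar (residual (x k)) (naiveMean x k - m) / (N k : ℝ)) with hV
  have h1 : (2 * w k - 1) * (‖naiveMean x k - m‖ ^ 2 - naiveRiskEst x k)
      ≤ |‖naiveMean x k - m‖ ^ 2 - naiveRiskEst x k| := by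
    refine (le_abs_self _).trans ?_
    rw [abs_mul]
    have : |2 * w k - 1| ≤ 1 := abs_le.2 ⟨by linarith [hw1.1 k], by linarith⟩
    exact mul_le_of_le_one_left (abs_nonneg _) this
  have h2 : 2 * ∑ l ∈ Finset.univ.erase k, w l * inner ℝ (naiveMean x l - m) (naiveMean x k - m)
      ≤ 16 * √u * penaltyEst x k w + 16 * √u * V := by
    have hsum : ∑ l ∈ Finset.univ.erase k, w l ≤ 1 := by
      rw [sum_erase_eq_one_sub hw1]; linarith [hw1.1 k]
    have hV0 : 0 ≤ 16 * √u * V := by positivity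
    calc 2 * ∑ l ∈ Finset.univ.erase k, w l * inner ℝ (naiveMean x l - m) (naiveMean x k - m)
        = ∑ l ∈ Finset.univ.erase k,
            w l * (2 * inner ℝ (naiveMean x l - m) (naiveMean x k - m)) := by
          rw [Finset.mul_sum]; exact Finset.sum_congr rfl fun l _ => by ring
      _ ≤ ∑ l ∈ Finset.univ.erase k, w l * (16 * √u * (V + √(qEst x k l / (N k : ℝ)))) := by
          refine Finset.sum_le_sum fun l hl => mul_le_mul_of_nonneg_left ?_ (hw1.1 l)
          refine (hG l (Finset.ne_of_mem_erase hl)).trans ?_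
          gcongr
          -- Seminorm inequality for `μ̂_l - m = (μ̂_k - m) - (μ̂_k - μ̂_l)`: the second direction
          -- is the one in `qEst`, the first gives `V`, which does not depend on `l`.
          rw [hV, qEst_eq_quadVar]
          simp_rw [Real.sqrt_div' _ (Nat.cast_nonneg (N k))]
          rw [← add_div]
          gcongr
          refine le_of_eq_of_le ?_ (sqrt_quadVar_sub_le _ _ _)
          congr 2; abel
      _ = 16 * √u * penaltyEst x k w + (∑ l ∈ Finset.univ.erase k, w l) * (16 * √u * V) := by
          rw [penaltyEst, Finset.mul_sum, Finset.sum_mul, ← Finset.sum_add_distrib]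
          exact Finset.sum_congr rfl fun l _ => by ring
      _ ≤ _ := by
          linarith [mul_le_of_le_one_left hV0 hsum]
  rw [norm_aggregate_sub_sq_eq (k := k) hw1]
  unfold objective at hmin ⊢
  linarith

end Pathwise

lemma integrable_inner_of_memLp {Ω E : Type*} [MeasurableSpace Ω] {P : Measure Ω}
    [NormedAddCommGroup E] [InnerProductSpace ℝ E] {f g : Ω → E} (hf : MemLp f 2 P)
    (hg : MemLp g 2 P) : Integrable (fun o => inner ℝ (f o) (g o)) P :=
  (hf.norm.integrable_mul hg.norm).mono' (hf.1.inner hg.1)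
    (Filter.Eventually.of_forall fun o => by
      simpa using norm_inner_le_norm (𝕜 := ℝ) (f o) (g o))

/-! ### Expectations in the Gaussian model -/

namespace IsGaussianModel

variable {d B : ℕ} {N : Fin B → ℕ} {Ω : Type*} [MeasurableSpace Ω] {P : Measure Ω}
  {X : Ω → Bags d B N} {μ : Fin B → EuclideanSpace ℝ (Fin d)}
  {S : Fin B → Matrix (Fin d) (Fin d) ℝ}

lemma isGaussianSample (h : IsGaussianModel P X μ S) (k : Fin B) :
    IsGaussianSample P (fun o => X o k) (μ k) (S k) where
  posSemidef := h.posSemidef k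
  hasLaw := h.hasLaw k
  indep := h.indep.precomp (g := fun i : Fin (N k) => (⟨k, i⟩ : (k : Fin B) × Fin (N k)))
    (fun a b hab => by simpa using hab)

lemma indepFun_bags (h : IsGaussianModel P X μ S) {k l : Fin B} (hkl : k ≠ l) :
    IndepFun (fun o => X o k) (fun o => X o l) P := by
  classical
  set T : Fin B → Finset ((k : Fin B) × Fin (N k)) := fun j =>
    Finset.univ.filter fun p => p.1 = j with hT
  have hdis : Disjoint (T k) (T l) := by
    rw [Finset.disjoint_left]
    intro p hp hq
    simp only [hT, Finset.mem_filter, Finset.mem_univ, true_and] at hp hq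
    exact hkl (hp.symm.trans hq)
  have hind := h.indep.indepFun_finset₀ (T k) (T l) hdis fun p => (h.hasLaw p.1 p.2).aemeasurable
  have hmem : ∀ (j : Fin B) (i : Fin (N j)),
      (⟨j, i⟩ : (k : Fin B) × Fin (N k)) ∈ T j := fun j i => by simp [hT]
  exact hind.comp
    (φ := fun f i => f ⟨⟨k, i⟩, hmem k i⟩) (ψ := fun f i => f ⟨⟨l, i⟩, hmem l i⟩)
    (measurable_pi_lambda _ fun i => measurable_pi_apply _)
    (measurable_pi_lambda _ fun i => measurable_pi_apply _)

lemma aemeasurable_naiveMean (h : IsGaussianModel P X μ S) (k : Fin B) :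
    AEMeasurable (fun o => naiveMean (X o) k) P :=
  continuous_sampleMean.measurable.comp_aemeasurable (h.isGaussianSample k).aemeasurable

lemma indepFun_naiveMean_sub (h : IsGaussianModel P X μ S) {k l : Fin B} (hkl : k ≠ l)
    (m : EuclideanSpace ℝ (Fin d)) :
    IndepFun (fun o => naiveMean (X o) k - m) (fun o => X o l) P :=
  (h.indepFun_bags hkl).comp (φ := fun y => sampleMean y - m) (ψ := fun y => y)
    (continuous_sampleMean.sub continuous_const).measurable measurable_id

lemma naiveRisk_nonneg (k : Fin B) : 0 ≤ naiveRisk P X μ k :=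
  integral_nonneg fun _ => sq_nonneg _

variable [IsProbabilityMeasure P]

lemma naiveRisk_eq (h : IsGaussianModel P X μ S) {k : Fin B} (hN : N k ≠ 0) :
    naiveRisk P X μ k = (S k).trace / N k :=
  (h.isGaussianSample k).integral_norm_sampleMean_sub_sq hN

lemma integrable_norm_naiveMean_sub_sq (h : IsGaussianModel P X μ S) {k : Fin B}
    (hN : N k ≠ 0) : Integrable (fun o => ‖naiveMean (X o) k - μ k‖ ^ 2) P :=
  (h.isGaussianSample k).integrable_norm_sampleMean_sub_sq hN

lemma memLp_naiveMean_sub (h : IsGaussianModel P X μ S) {k : Fin B} (hN : N k ≠ 0)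
    (m : EuclideanSpace ℝ (Fin d)) : MemLp (fun o => naiveMean (X o) k - m) 2 P := by
  have h1 : MemLp (fun o => naiveMean (X o) k - μ k) 2 P :=
    (memLp_two_iff_integrable_sq_norm
      ((h.aemeasurable_naiveMean k).sub_const _).aestronglyMeasurable).2
      (h.integrable_norm_naiveMean_sub_sq hN)
  have h2 := h1.add (memLp_const (μ k - m))
  refine h2.ae_eq (Filter.Eventually.of_forall fun o => ?_)
  simp

lemma integral_inner_naiveMean_sub_const (h : IsGaussianModel P X μ S) {k : Fin B}
    (hN : N k ≠ 0) (v : EuclideanSpace ℝ (Fin d)) :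
    ∫ o, inner ℝ v (naiveMean (X o) k - μ k) ∂P = 0 :=
  ((h.isGaussianSample k).isCenteredGaussian_sampleMean_sub hN).integral_inner v

lemma integrable_inner_naiveMean_sub (h : IsGaussianModel P X μ S) (hN : ∀ k, N k ≠ 0)
    (k l : Fin B) (m m' : EuclideanSpace ℝ (Fin d)) :
    Integrable (fun o => inner ℝ (naiveMean (X o) k - m) (naiveMean (X o) l - m')) P :=
  integrable_inner_of_memLp (h.memLp_naiveMean_sub (hN k) m) (h.memLp_naiveMean_sub (hN l) m')

lemma integral_inner_naiveMean_sub_of_ne (h : IsGaussianModel P X μ S) (hN : ∀ k, N k ≠ 0)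
    {k l : Fin B} (hkl : k ≠ l) (m : EuclideanSpace ℝ (Fin d)) :
    ∫ o, inner ℝ (naiveMean (X o) k - m) (naiveMean (X o) l - μ l) ∂P = 0 := by
  have hi1 := (h.memLp_naiveMean_sub (hN k) m).integrable (by norm_num)
  have hi2 := (h.memLp_naiveMean_sub (hN l) (μ l)).integrable (by norm_num)
  have hind : IndepFun (fun o => naiveMean (X o) k - m) (fun o => naiveMean (X o) l - μ l) P :=
    (h.indepFun_naiveMean_sub hkl m).comp (φ := fun y => y)
      (ψ := fun y => sampleMean y - μ l) measurable_id
      (continuous_sampleMean.sub continuous_const).measurable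
  have h1 := hind.integral_bilin hi1 hi2 (innerSL ℝ)
  change ∫ o, inner ℝ (naiveMean (X o) k - m) (naiveMean (X o) l - μ l) ∂P
    = inner ℝ (∫ o, naiveMean (X o) k - m ∂P) (∫ o, naiveMean (X o) l - μ l ∂P) at h1
  rw [h1, ← _root_.integral_inner hi2, h.integral_inner_naiveMean_sub_const (hN l)]

lemma integral_inner_naiveMean_sub (h : IsGaussianModel P X μ S) (hN : ∀ k, N k ≠ 0)
    (k l : Fin B) :
    ∫ o, inner ℝ (naiveMean (X o) k - μ k) (naiveMean (X o) l - μ l) ∂P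
      = if k = l then naiveRisk P X μ k else 0 := by
  split_ifs with hkl
  · subst hkl
    simp_rw [real_inner_self_eq_norm_sq]
    rfl
  · exact h.integral_inner_naiveMean_sub_of_ne hN hkl (μ k)

lemma aggregate_sub_eq_sum {w : Fin B → ℝ} (hw : w ∈ stdSimplex ℝ (Fin B)) (x : Bags d B N)
    (m : EuclideanSpace ℝ (Fin d)) :
    aggregate x w - m = ∑ l, w l • (naiveMean x l - μ l) + ∑ l, w l • (μ l - m) := by
  simp_rw [smul_sub, Finset.sum_sub_distrib, ← Finset.sum_smul, hw.2, one_smul]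
  rw [aggregate]
  abel

lemma norm_aggregate_sub_sq_eq_sum {w : Fin B → ℝ} (hw : w ∈ stdSimplex ℝ (Fin B))
    (x : Bags d B N) (m : EuclideanSpace ℝ (Fin d)) :
    ‖aggregate x w - m‖ ^ 2
      = ∑ l, ∑ j, w l * w j * inner ℝ (naiveMean x l - μ l) (naiveMean x j - μ j)
        + 2 * ∑ l, w l * inner ℝ (∑ j, w j • (μ j - m)) (naiveMean x l - μ l)
        + ‖∑ l, w l • (μ l - m)‖ ^ 2 := by
  rw [aggregate_sub_eq_sum (μ := μ) hw, norm_add_sq_real]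
  congr 2
  · rw [← real_inner_self_eq_norm_sq, sum_inner]
    refine Finset.sum_congr rfl fun l _ => ?_
    rw [inner_sum]
    refine Finset.sum_congr rfl fun j _ => ?_
    rw [real_inner_smul_left, real_inner_smul_right, mul_assoc]
  · rw [real_inner_comm, inner_sum]
    congr 1
    refine Finset.sum_congr rfl fun l _ => ?_
    rw [real_inner_smul_right]

/-- Bias-variance decomposition for a fixed weight vector. -/
lemma integral_norm_aggregate_sub_sq (h : IsGaussianModel P X μ S) (hN : ∀ k, N k ≠ 0)
    {w : Fin B → ℝ} (hw : w ∈ stdSimplex ℝ (Fin B)) (m : EuclideanSpace ℝ (Fin d)) :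
    Integrable (fun o => ‖aggregate (X o) w - m‖ ^ 2) P ∧
    ∫ o, ‖aggregate (X o) w - m‖ ^ 2 ∂P
      = ∑ l, w l ^ 2 * naiveRisk P X μ l + ‖∑ l, w l • (μ l - m)‖ ^ 2 := by
  simp_rw [norm_aggregate_sub_sq_eq_sum (μ := μ) hw]
  set b := ∑ l, w l • (μ l - m) with hb
  have i1 : ∀ l j, Integrable (fun o => w l * w j *
      inner ℝ (naiveMean (X o) l - μ l) (naiveMean (X o) j - μ j)) P := fun l j =>
    (h.integrable_inner_naiveMean_sub hN l j _ _).const_mul _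
  have i2 : ∀ l, Integrable (fun o => w l * inner ℝ b (naiveMean (X o) l - μ l)) P := fun l =>
    (integrable_inner_of_memLp (memLp_const b) (h.memLp_naiveMean_sub (hN l) (μ l))).const_mul _
  have i3 : ∀ l, Integrable (fun o => ∑ j, w l * w j *
      inner ℝ (naiveMean (X o) l - μ l) (naiveMean (X o) j - μ j)) P := fun l =>
    integrable_finsetSum _ fun j _ => i1 l j
  have i4 : Integrable (fun o => ∑ l, ∑ j, w l * w j *
      inner ℝ (naiveMean (X o) l - μ l) (naiveMean (X o) j - μ j)) P :=
    integrable_finsetSum _ fun l _ => i3 l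
  have i5 : Integrable (fun o => 2 * ∑ l, w l * inner ℝ b (naiveMean (X o) l - μ l)) P :=
    (integrable_finsetSum _ fun l _ => i2 l).const_mul _
  have i6 : Integrable (fun o => ∑ l, ∑ j, w l * w j *
      inner ℝ (naiveMean (X o) l - μ l) (naiveMean (X o) j - μ j)
      + 2 * ∑ l, w l * inner ℝ b (naiveMean (X o) l - μ l)) P := i4.add i5
  refine ⟨i6.add (integrable_const _), ?_⟩
  rw [integral_add i6 (integrable_const _), integral_add i4 i5, integral_const_mul,
    integral_finsetSum _ fun l _ => i3 l, integral_finsetSum _ fun l _ => i2 l]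
  simp_rw [integral_finsetSum _ fun j _ => i1 _ j, integral_const_mul,
    h.integral_inner_naiveMean_sub hN, h.integral_inner_naiveMean_sub_const (hN _)]
  simp [sq]

lemma integrable_naiveRiskEst (h : IsGaussianModel P X μ S) {k : Fin B} (hN : 1 < N k) :
    Integrable (fun o => naiveRiskEst (X o) k) P :=
  (h.isGaussianSample k).integrable_meanRiskEst hN

lemma integral_naiveRiskEst (h : IsGaussianModel P X μ S) {k : Fin B} (hN : 1 < N k) :
    ∫ o, naiveRiskEst (X o) k ∂P = naiveRisk P X μ k := by
  rw [h.naiveRisk_eq (by omega)]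
  exact (h.isGaussianSample k).integral_meanRiskEst hN

/-- For a deterministic `w` both correction terms are centred: `naiveRiskEst` is unbiased and `μ̂_l`
is independent of `μ̂_k` for `l ≠ k`. So `lossEst` has the bias-variance value as its mean. -/
lemma integral_lossEst (h : IsGaussianModel P X μ S) (hN : ∀ k, 1 < N k) (k : Fin B)
    {w : Fin B → ℝ} (hw : w ∈ stdSimplex ℝ (Fin B)) :
    Integrable (fun o => lossEst (X o) k w) P ∧
    ∫ o, lossEst (X o) k w ∂P
      = ∑ l, w l ^ 2 * naiveRisk P X μ l + ‖∑ l, w l • (μ l - μ k)‖ ^ 2 := by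
  have hN0 : ∀ k, N k ≠ 0 := fun k => by have := hN k; omega
  obtain ⟨j1, j2⟩ := h.integral_norm_aggregate_sub_sq hN0 hw (μ k)
  have e : ∀ o, lossEst (X o) k w = ‖aggregate (X o) w - μ k‖ ^ 2
      - (2 * w k - 1) * (‖naiveMean (X o) k - μ k‖ ^ 2 - naiveRiskEst (X o) k)
      - 2 * ∑ l ∈ Finset.univ.erase k,
          w l * inner ℝ (naiveMean (X o) l - μ k) (naiveMean (X o) k - μ k) := fun o => by
    rw [norm_aggregate_sub_sq_eq (k := k) hw]; ring
  have i1 := h.integrable_norm_naiveMean_sub_sq (hN0 k)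
  have i2 := h.integrable_naiveRiskEst (hN k)
  have i3 : ∀ l, Integrable (fun o => w l * inner ℝ (naiveMean (X o) l - μ k)
      (naiveMean (X o) k - μ k)) P := fun l =>
    (h.integrable_inner_naiveMean_sub hN0 l k _ _).const_mul _
  have i4 : Integrable (fun o => 2 * ∑ l ∈ Finset.univ.erase k,
      w l * inner ℝ (naiveMean (X o) l - μ k) (naiveMean (X o) k - μ k)) P :=
    (integrable_finsetSum _ fun l _ => i3 l).const_mul _
  have i5 : Integrable (fun o => (2 * w k - 1) *
      (‖naiveMean (X o) k - μ k‖ ^ 2 - naiveRiskEst (X o) k)) P := (i1.sub i2).const_mul _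
  have i6 : Integrable (fun o => ‖aggregate (X o) w - μ k‖ ^ 2 - (2 * w k - 1) *
      (‖naiveMean (X o) k - μ k‖ ^ 2 - naiveRiskEst (X o) k)) P := j1.sub i5
  simp_rw [e]
  refine ⟨i6.sub i4, ?_⟩
  have h1 : ∫ o, ‖naiveMean (X o) k - μ k‖ ^ 2 ∂P = naiveRisk P X μ k := rfl
  have h2 : ∑ l ∈ Finset.univ.erase k, ∫ o, w l * inner ℝ (naiveMean (X o) l - μ k)
      (naiveMean (X o) k - μ k) ∂P = 0 := by
    refine Finset.sum_eq_zero fun l hl => ?_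
    rw [integral_const_mul,
      h.integral_inner_naiveMean_sub_of_ne hN0 (Finset.ne_of_mem_erase hl), mul_zero]
  rw [integral_sub i6 i4, integral_sub j1 i5, integral_const_mul, integral_const_mul,
    integral_finsetSum _ fun l _ => i3 l, integral_sub i1 i2, h.integral_naiveRiskEst (hN k), h1,
    j2, h2]
  ring

lemma integral_norm_naiveMean_sub_sq (h : IsGaussianModel P X μ S) {l : Fin B} (hN : N l ≠ 0)
    (m : EuclideanSpace ℝ (Fin d)) :
    ∫ o, ‖naiveMean (X o) l - m‖ ^ 2 ∂P = naiveRisk P X μ l + ‖μ l - m‖ ^ 2 := by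
  have e : ∀ o, ‖naiveMean (X o) l - m‖ ^ 2 = ‖naiveMean (X o) l - μ l‖ ^ 2
      + 2 * inner ℝ (μ l - m) (naiveMean (X o) l - μ l) + ‖μ l - m‖ ^ 2 := fun o => by
    rw [real_inner_comm, ← norm_add_sq_real]; congr 2; abel
  have i1 := h.integrable_norm_naiveMean_sub_sq hN
  have i2 : Integrable (fun o => 2 * inner ℝ (μ l - m) (naiveMean (X o) l - μ l)) P :=
    (integrable_inner_of_memLp (memLp_const _) (h.memLp_naiveMean_sub hN (μ l))).const_mul _
  have i3 : Integrable (fun o => ‖naiveMean (X o) l - μ l‖ ^ 2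
      + 2 * inner ℝ (μ l - m) (naiveMean (X o) l - μ l)) P := i1.add i2
  simp_rw [e]
  rw [integral_add i3 (integrable_const _), integral_add i1 i2, integral_const_mul,
    h.integral_inner_naiveMean_sub_const hN]
  simp [naiveRisk, risk, loss]

/-- The direction comes from the same bag as the residuals, yet is independent of them, since mean
and residuals of a Gaussian sample are independent. -/
lemma integral_sqrt_quadVar_naiveMean_self_le (h : IsGaussianModel P X μ S) {k : Fin B}
    (hN : 1 < N k) :
    Integrable (fun o => √(quadVar (residual (X o k)) (naiveMean (X o) k - μ k) / N k)) P ∧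
    ∫ o, √(quadVar (residual (X o k)) (naiveMean (X o) k - μ k) / N k) ∂P
      ≤ √(‖covOp (S k)‖ / N k) * √(naiveRisk P X μ k) := by
  have hk := h.isGaussianSample k
  have hA := (h.aemeasurable_naiveMean k).sub_const (μ k)
  have hind := hk.indepFun_sampleMean_sub_residual (by omega)
  have hi := h.integrable_norm_naiveMean_sub_sq (k := k) (by omega)
  exact ⟨hk.integrable_sqrt_quadVar_div hN hA hind hi,
    hk.integral_sqrt_quadVar_div_le hN hA hind hi⟩

lemma integral_sqrt_quadVar_naiveMean_le (h : IsGaussianModel P X μ S) (hN : ∀ k, 1 < N k)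
    {k l : Fin B} (hkl : l ≠ k) :
    Integrable (fun o => √(quadVar (residual (X o k)) (naiveMean (X o) l - μ k) / N k)) P ∧
    ∫ o, √(quadVar (residual (X o k)) (naiveMean (X o) l - μ k) / N k) ∂P
      ≤ √(‖covOp (S k)‖ / N k) * (√(naiveRisk P X μ l) + ‖μ l - μ k‖) := by
  have hk := h.isGaussianSample k
  have hNl : N l ≠ 0 := by have := hN l; omega
  have hA := (h.aemeasurable_naiveMean l).sub_const (μ k)
  have hind : IndepFun (fun o => naiveMean (X o) l - μ k) (fun o => residual (X o k)) P :=
    (h.indepFun_naiveMean_sub hkl (μ k)).comp (φ := fun y => y) measurable_id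
      continuous_residual.measurable
  have hi : Integrable (fun o => ‖naiveMean (X o) l - μ k‖ ^ 2) P :=
    (memLp_two_iff_integrable_sq_norm hA.aestronglyMeasurable).1
      (h.memLp_naiveMean_sub hNl (μ k))
  refine ⟨hk.integrable_sqrt_quadVar_div (hN k) hA hind hi,
    (hk.integral_sqrt_quadVar_div_le (hN k) hA hind hi).trans ?_⟩
  gcongr
  rw [h.integral_norm_naiveMean_sub_sq hNl]
  refine Real.sqrt_le_iff.2 ⟨by positivity, ?_⟩
  have := Real.sq_sqrt (naiveRisk_nonneg (P := P) (X := X) (μ := μ) l)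
  nlinarith [mul_nonneg (Real.sqrt_nonneg (naiveRisk P X μ l)) (norm_nonneg (μ l - μ k))]

lemma integral_sqrt_qEst_le (h : IsGaussianModel P X μ S) (hN : ∀ k, 1 < N k)
    {k l : Fin B} (hkl : l ≠ k) :
    Integrable (fun o => √(qEst (X o) k l / N k)) P ∧
    ∫ o, √(qEst (X o) k l / N k) ∂P
      ≤ √(‖covOp (S k)‖ / N k)
        * (√(naiveRisk P X μ l) + ‖μ l - μ k‖ + √(naiveRisk P X μ k)) := by
  obtain ⟨i1, b1⟩ := h.integral_sqrt_quadVar_naiveMean_self_le (hN k)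
  obtain ⟨i2, b2⟩ := h.integral_sqrt_quadVar_naiveMean_le hN hkl
  have hpt : ∀ o, √(qEst (X o) k l / N k)
      ≤ √(quadVar (residual (X o k)) (naiveMean (X o) l - μ k) / N k)
        + √(quadVar (residual (X o k)) (naiveMean (X o) k - μ k) / N k) := by
    intro o
    rw [qEst_eq_quadVar]
    simp_rw [Real.sqrt_div' _ (Nat.cast_nonneg (N k))]
    rw [← add_div, add_comm]
    gcongr
    refine le_of_eq_of_le ?_ (sqrt_quadVar_sub_le _ _ _)
    congr 2; abel
  have i12 : Integrable (fun o =>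
      √(quadVar (residual (X o k)) (naiveMean (X o) l - μ k) / N k)
        + √(quadVar (residual (X o k)) (naiveMean (X o) k - μ k) / N k)) P := i2.add i1
  have hmeas : AEMeasurable (fun o => √(qEst (X o) k l / N k)) P := by
    have hr : AEMeasurable (fun o => residual (X o k)) P :=
      continuous_residual.measurable.comp_aemeasurable (h.isGaussianSample k).aemeasurable
    exact ((aemeasurable_quadVar hr ((h.aemeasurable_naiveMean k).sub
      (h.aemeasurable_naiveMean l))).div_const _).sqrt
  have i0 : Integrable (fun o => √(qEst (X o) k l / N k)) P :=
    i12.mono' hmeas.aestronglyMeasurable (Filter.Eventually.of_forall fun o => by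
      rw [Real.norm_of_nonneg (Real.sqrt_nonneg _)]; exact hpt o)
  refine ⟨i0, (integral_mono i0 i12 hpt).trans ?_⟩
  rw [integral_add i2 i1]
  linarith

lemma integral_objective_le (h : IsGaussianModel P X μ S) (hN : ∀ k, 1 < N k) (k : Fin B)
    (u : ℝ) {w : Fin B → ℝ} (hw : w ∈ stdSimplex ℝ (Fin B)) :
    Integrable (fun o => objective u (X o) k w) P ∧
    ∫ o, objective u (X o) k w ∂P
      ≤ ∑ l, w l ^ 2 * naiveRisk P X μ l + ‖∑ l, w l • (μ l - μ k)‖ ^ 2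
        + 16 * √u * ∑ l ∈ Finset.univ.erase k, w l * (√(‖covOp (S k)‖ / N k)
            * (√(naiveRisk P X μ l) + ‖μ l - μ k‖ + √(naiveRisk P X μ k))) := by
  obtain ⟨i1, e1⟩ := h.integral_lossEst hN k hw
  have i2 : ∀ l ∈ Finset.univ.erase k, Integrable (fun o => w l * √(qEst (X o) k l / N k)) P :=
    fun l hl => (h.integral_sqrt_qEst_le hN (Finset.ne_of_mem_erase hl)).1.const_mul _
  have i3 : Integrable (fun o => 16 * √u * penaltyEst (X o) k w) P :=
    (integrable_finsetSum _ i2).const_mul _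
  refine ⟨i1.add i3, ?_⟩
  simp_rw [objective]
  rw [integral_add i1 i3, e1, integral_const_mul]
  simp_rw [penaltyEst]
  rw [integral_finsetSum _ i2]
  gcongr with l hl
  rw [integral_const_mul]
  exact mul_le_mul_of_nonneg_left (h.integral_sqrt_qEst_le hN (Finset.ne_of_mem_erase hl)).2
    (hw.1 l)

end IsGaussianModel

/-! ### The bad event and the oracle inequality for one task -/

namespace IsGaussianModel

variable {d B : ℕ} {N : Fin B → ℕ} {Ω : Type*} [MeasurableSpace Ω] {P : Measure Ω}
  [IsProbabilityMeasure P] {X : Ω → Bags d B N} {μ : Fin B → EuclideanSpace ℝ (Fin d)}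
  {S : Fin B → Matrix (Fin d) (Fin d) ℝ}

/-- The event that some cross term of task `k` is not dominated by its penalty. -/
def crossTermEvent (X : Ω → Bags d B N) (μ : Fin B → EuclideanSpace ℝ (Fin d)) (k : Fin B)
    (u : ℝ) : Set Ω :=
  ⋃ l ∈ Finset.univ.erase k, {o | 16 * √u
      * √(quadVar (residual (X o k)) (naiveMean (X o) l - μ k) / (N k : ℝ))
    < 2 * inner ℝ (naiveMean (X o) l - μ k) (naiveMean (X o) k - μ k)}

lemma measureReal_crossTermEvent_le (h : IsGaussianModel P X μ S) {k : Fin B} {u : ℝ} (hu : 0 < u)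
    (hun : u ≤ ((N k : ℝ) - 1) / 2) :
    P.real (crossTermEvent X μ k u) ≤ B * (√2 * Real.exp (-(3 / 2 * u))) := by
  refine ENNReal.toReal_le_of_le_ofReal (by positivity) ?_
  refine (measure_biUnion_finset_le _ _).trans ?_
  calc ∑ l ∈ Finset.univ.erase k, P {o | 16 * √u
          * √(quadVar (residual (X o k)) (naiveMean (X o) l - μ k) / (N k : ℝ))
        < 2 * inner ℝ (naiveMean (X o) l - μ k) (naiveMean (X o) k - μ k)}
      ≤ ∑ _l ∈ Finset.univ.erase k, ENNReal.ofReal (√2 * Real.exp (-(3 / 2 * u))) :=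
        Finset.sum_le_sum fun l hl => (h.isGaussianSample k).student_tail_of_indepFun
          ((h.aemeasurable_naiveMean l).sub_const (μ k))
          (h.indepFun_naiveMean_sub (Finset.ne_of_mem_erase hl) (μ k)) hu hun
    _ ≤ ∑ _l : Fin B, ENNReal.ofReal (√2 * Real.exp (-(3 / 2 * u))) :=
        Finset.sum_le_sum_of_subset (Finset.subset_univ _)
    _ = ENNReal.ofReal (B * (√2 * Real.exp (-(3 / 2 * u)))) := by
        rw [ENNReal.ofReal_mul (Nat.cast_nonneg B), ENNReal.ofReal_natCast]
        simp

lemma integrable_loss_aggregate (h : IsGaussianModel P X μ S) {k : Fin B} (hN : 1 < N k)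
    {u : ℝ} {w : Ω → Fin B → ℝ} (hwm : AEMeasurable w P)
    (hw : ∀ᵐ o ∂P, IsQWeight u (X o) k (w o)) :
    Integrable (fun o => ‖aggregate (X o) (w o) - μ k‖ ^ 2) P := by
  have hm : AEMeasurable (fun o => aggregate (X o) (w o)) P := by
    unfold aggregate
    refine Finset.aemeasurable_fun_sum _ fun l _ => ?_
    exact ((measurable_pi_apply l).comp_aemeasurable hwm).smul (h.aemeasurable_naiveMean l)
  have hb : Integrable (fun o => 4 * naiveRiskEst (X o) k + 2 * ‖naiveMean (X o) k - μ k‖ ^ 2) P :=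
    ((h.integrable_naiveRiskEst hN).const_mul _).add
      ((h.integrable_norm_naiveMean_sub_sq (by omega)).const_mul _)
  refine hb.mono' ((hm.sub_const _).norm.pow_const 2).aestronglyMeasurable ?_
  filter_upwards [hw] with o ho
  rw [Real.norm_of_nonneg (by positivity)]
  exact ho.norm_aggregate_sub_sq_le hN

lemma integral_abs_norm_naiveMean_sub_sq_le (h : IsGaussianModel P X μ S) {k : Fin B}
    (hN : N k ≠ 0) :
    ∫ o, |‖naiveMean (X o) k - μ k‖ ^ 2 - naiveRisk P X μ k| ∂P
      ≤ √2 * (√(‖covOp (S k)‖ * (S k).trace) / N k) := by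
  rw [h.naiveRisk_eq hN]
  exact (h.isGaussianSample k).integral_abs_norm_sampleMean_sub_sq_le hN

lemma integral_abs_naiveRiskEst_sub_le (h : IsGaussianModel P X μ S) {k : Fin B}
    (hN : 1 < N k) :
    ∫ o, |naiveRiskEst (X o) k - naiveRisk P X μ k| ∂P
      ≤ 3 * √2 * (√(‖covOp (S k)‖ * (S k).trace) / N k) := by
  rw [h.naiveRisk_eq (by omega)]
  exact (h.isGaussianSample k).integral_abs_meanRiskEst_sub_le hN

/-- Oracle inequality for a single task. -/
lemma risk_aggregate_le (h : IsGaussianModel P X μ S) (hN : ∀ k, 1 < N k) {k : Fin B}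
    {u : ℝ} (hu : 0 < u) (hun : u ≤ ((N k : ℝ) - 1) / 2) {w : Ω → Fin B → ℝ}
    (hwm : AEMeasurable w P) (hw : ∀ᵐ o ∂P, IsQWeight u (X o) k (w o)) {w' : Fin B → ℝ}
    (hw' : w' ∈ stdSimplex ℝ (Fin B)) :
    risk P (fun o => aggregate (X o) (w o)) (μ k)
      ≤ ∑ l, w' l ^ 2 * naiveRisk P X μ l + ‖∑ l, w' l • (μ l - μ k)‖ ^ 2
        + 16 * √u * ∑ l ∈ Finset.univ.erase k, w' l * (√(‖covOp (S k)‖ / N k)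
            * (√(naiveRisk P X μ l) + ‖μ l - μ k‖ + √(naiveRisk P X μ k)))
        + 21 * √2 * (√(‖covOp (S k)‖ * (S k).trace) / N k)
        + 16 * √u * (√(‖covOp (S k)‖ / N k) * √(naiveRisk P X μ k))
        + 7 * naiveRisk P X μ k * (B * (√2 * Real.exp (-(3 / 2 * u)))) := by
  classical
  have hNk : N k ≠ 0 := by have := hN k; omega
  set s := naiveRisk P X μ k with hs
  have hs0 : 0 ≤ s := naiveRisk_nonneg k
  -- The data are only almost everywhere measurable, so the event is replaced by a measurable hull
  -- of the same probability.
  set G := toMeasurable P (crossTermEvent X μ k u) with hG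
  have hGm : MeasurableSet G := measurableSet_toMeasurable _ _
  have hGP : P.real G ≤ B * (√2 * Real.exp (-(3 / 2 * u))) := by
    rw [measureReal_def, hG, measure_toMeasurable]
    exact h.measureReal_crossTermEvent_le hu hun
  obtain ⟨iO, bO⟩ := h.integral_objective_le hN k u hw'
  obtain ⟨iV, bV⟩ := h.integral_sqrt_quadVar_naiveMean_self_le (hN k)
  have iE : Integrable (fun o => |‖naiveMean (X o) k - μ k‖ ^ 2 - s|) P :=
    ((h.integrable_norm_naiveMean_sub_sq hNk).sub (integrable_const _)).abs
  have iR : Integrable (fun o => |naiveRiskEst (X o) k - s|) P :=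
    ((h.integrable_naiveRiskEst (hN k)).sub (integrable_const _)).abs
  have iI : Integrable (fun o => G.indicator (fun _ => 7 * s) o) P :=
    (integrable_const _).indicator hGm
  -- One bound valid on both events: the fluctuations stay outside the indicator, so on the bad
  -- event only the constant `7 * s` is multiplied by its probability and no higher moment of the
  -- loss is needed.
  have hpt : ∀ᵐ o ∂P, ‖aggregate (X o) (w o) - μ k‖ ^ 2 ≤ objective u (X o) k w'
      + 3 * |‖naiveMean (X o) k - μ k‖ ^ 2 - s| + 6 * |naiveRiskEst (X o) k - s|
      + 16 * √u * √(quadVar (residual (X o k)) (naiveMean (X o) k - μ k) / N k)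
      + G.indicator (fun _ => 7 * s) o := by
    filter_upwards [hw] with o ho
    have a1 := abs_nonneg (‖naiveMean (X o) k - μ k‖ ^ 2 - s)
    have a2 := abs_nonneg (naiveRiskEst (X o) k - s)
    have a3 := le_abs_self (‖naiveMean (X o) k - μ k‖ ^ 2 - s)
    have a4 := le_abs_self (naiveRiskEst (X o) k - s)
    have a5 : 0 ≤ 16 * √u * √(quadVar (residual (X o k)) (naiveMean (X o) k - μ k) / N k) := by
      positivity
    by_cases hoG : o ∈ G
    -- Here `7 = 4 + 2 + 1`: the crude bound gives `4 s + 2 s`, and one more `s` compensates an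
    -- objective as low as `-naiveRiskEst`.
    · rw [Set.indicator_of_mem hoG]
      have h1 := ho.norm_aggregate_sub_sq_le (m := μ k) (hN k)
      have h2 := sub_naiveRiskEst_le_objective (x := X o) (u := u) (hN k) hw'
      have h3 := sq_nonneg
        ‖∑ l ∈ Finset.univ.erase k, w' l • (naiveMean (X o) l - naiveMean (X o) k)‖
      linarith
    · rw [Set.indicator_of_notMem hoG]
      have hcross : ∀ l ≠ k, 2 * inner ℝ (naiveMean (X o) l - μ k) (naiveMean (X o) k - μ k)
          ≤ 16 * √u * √(quadVar (residual (X o k)) (naiveMean (X o) l - μ k) / (N k : ℝ)) := by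
        intro l hl
        by_contra hcon
        refine hoG (subset_toMeasurable _ _ ?_)
        simp only [crossTermEvent, Set.mem_iUnion]
        exact ⟨l, Finset.mem_erase.2 ⟨hl, Finset.mem_univ _⟩, not_le.1 hcon⟩
      have h1 := ho.norm_aggregate_sub_sq_le_objective hw' hcross
      have h2 : |‖naiveMean (X o) k - μ k‖ ^ 2 - naiveRiskEst (X o) k|
          ≤ |‖naiveMean (X o) k - μ k‖ ^ 2 - s| + |naiveRiskEst (X o) k - s| := by
        rw [show ‖naiveMean (X o) k - μ k‖ ^ 2 - naiveRiskEst (X o) k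
          = (‖naiveMean (X o) k - μ k‖ ^ 2 - s) - (naiveRiskEst (X o) k - s) by ring]
        exact abs_sub _ _
      linarith
  have j1 : Integrable (fun o => objective u (X o) k w'
      + 3 * |‖naiveMean (X o) k - μ k‖ ^ 2 - s|) P := iO.add (iE.const_mul _)
  have j2 : Integrable (fun o => objective u (X o) k w'
      + 3 * |‖naiveMean (X o) k - μ k‖ ^ 2 - s| + 6 * |naiveRiskEst (X o) k - s|) P :=
    j1.add (iR.const_mul _)
  have j3 : Integrable (fun o => objective u (X o) k w'
      + 3 * |‖naiveMean (X o) k - μ k‖ ^ 2 - s| + 6 * |naiveRiskEst (X o) k - s|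
      + 16 * √u * √(quadVar (residual (X o k)) (naiveMean (X o) k - μ k) / N k)) P :=
    j2.add (iV.const_mul _)
  have hle := integral_mono_ae (h.integrable_loss_aggregate (hN k) hwm hw) (j3.add iI) hpt
  have hrisk : risk P (fun o => aggregate (X o) (w o)) (μ k)
      = ∫ o, ‖aggregate (X o) (w o) - μ k‖ ^ 2 ∂P := rfl
  rw [hrisk]
  refine hle.trans ?_
  simp only [Pi.add_apply]
  rw [integral_add j3 iI, integral_add j2 (iV.const_mul _), integral_add j1 (iR.const_mul _),
    integral_add iO (iE.const_mul _), integral_const_mul, integral_const_mul, integral_const_mul,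
    integral_indicator_const _ hGm]
  have bE := h.integral_abs_norm_naiveMean_sub_sq_le hNk
  have bR := h.integral_abs_naiveRiskEst_sub_le (hN k)
  have bI : P.real G • (7 * s) ≤ 7 * s * (B * (√2 * Real.exp (-(3 / 2 * u)))) := by
    rw [smul_eq_mul, mul_comm]
    gcongr
  have bV' := mul_le_mul_of_nonneg_left bV (by positivity : 0 ≤ 16 * √u)
  linarith

end IsGaussianModel

/-! ### Oracle weights inside a group of tasks -/

section Oracle

variable {d B : ℕ} {s2 : Fin B → ℝ} {c : Finset (Fin B)} {k : Fin B} {ζ τ ν : ℝ}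

/-- Used for the lower bound on the oracle risk: the ratios `ν` of a group sum to one. -/
lemma oracleBound_ge (hτ : 0 ≤ τ) (hν1 : ν ≤ 1) : ν ≤ oracleBound τ ν := by
  have hp : 0 ≤ 1 - ν := by linarith
  have hD : 0 < 1 + τ * (1 - ν) := by positivity
  have h1 : 0 < 1 + τ := by positivity
  have e : oracleBound τ ν - ν
      = (τ * (1 - ν) ^ 2 + τ ^ 2 * (1 - ν) ^ 2) / ((1 + τ) * (1 + τ * (1 - ν))) := by
    rw [oracleBound]
    field_simp
    ring
  have : 0 ≤ oracleBound τ ν - ν := by rw [e]; positivity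
  linarith

lemma aggVar_pos (hs : ∀ k, 0 < s2 k) (hc : c.Nonempty) : 0 < aggVar s2 c :=
  inv_pos.2 (Finset.sum_pos (fun j _ => one_div_pos.2 (hs j)) hc)

lemma aggVar_mul_sum (hs : ∀ k, 0 < s2 k) (hc : c.Nonempty) :
    aggVar s2 c * ∑ j ∈ c, 1 / s2 j = 1 :=
  inv_mul_cancel₀ (Finset.sum_pos (fun j _ => one_div_pos.2 (hs j)) hc).ne'

lemma sum_aggVar_div (hs : ∀ k, 0 < s2 k) (hc : c.Nonempty) :
    ∑ j ∈ c, aggVar s2 c / s2 j = 1 := by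
  rw [← aggVar_mul_sum hs hc, Finset.mul_sum]
  exact Finset.sum_congr rfl fun j _ => by ring

lemma aggVar_div_le_one (hs : ∀ k, 0 < s2 k) (hk : k ∈ c) : aggVar s2 c / s2 k ≤ 1 := by
  have hc : c.Nonempty := ⟨k, hk⟩
  rw [← sum_aggVar_div hs hc]
  exact Finset.single_le_sum (f := fun j => aggVar s2 c / s2 j)
    (fun j _ => (div_pos (aggVar_pos hs hc) (hs j)).le) hk

lemma sum_erase_aggVar_div (hs : ∀ k, 0 < s2 k) (hk : k ∈ c) :
    ∑ j ∈ c.erase k, aggVar s2 c / s2 j = 1 - aggVar s2 c / s2 k := by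
  rw [← sum_aggVar_div hs ⟨k, hk⟩, ← Finset.add_sum_erase _ _ hk]
  ring

/-- The oracle weights of task `k` inside its group `c`, for a diameter bound `ζ`. -/
def oracleWeight (s2 : Fin B → ℝ) (c : Finset (Fin B)) (ζ : ℝ) (k l : Fin B) : ℝ :=
  if l = k then 1 - (1 - aggVar s2 c / s2 k) / (1 + ζ ^ 2 / s2 k * (1 - aggVar s2 c / s2 k))
  else if l ∈ c then
    aggVar s2 c / s2 l / (1 + ζ ^ 2 / s2 k * (1 - aggVar s2 c / s2 k)) else 0

lemma sum_erase_oracleWeight_mul (f : Fin B → ℝ) :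
    ∑ l ∈ Finset.univ.erase k, oracleWeight s2 c ζ k l * f l
      = ∑ l ∈ c.erase k, aggVar s2 c / s2 l
          / (1 + ζ ^ 2 / s2 k * (1 - aggVar s2 c / s2 k)) * f l := by
  have h1 : c.erase k ⊆ Finset.univ.erase k := Finset.erase_subset_erase _ (Finset.subset_univ _)
  rw [← Finset.sum_subset h1]
  · refine Finset.sum_congr rfl fun l hl => ?_
    rw [oracleWeight, if_neg (Finset.ne_of_mem_erase hl), if_pos (Finset.mem_of_mem_erase hl)]
  · intro l hl hlc
    have hne := Finset.ne_of_mem_erase hl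
    have : l ∉ c := fun h => hlc (Finset.mem_erase.2 ⟨hne, h⟩)
    rw [oracleWeight, if_neg hne, if_neg this, zero_mul]

lemma one_le_oracleDenom (hs : ∀ k, 0 < s2 k) (hk : k ∈ c) :
    1 ≤ 1 + ζ ^ 2 / s2 k * (1 - aggVar s2 c / s2 k) := by
  have h1 := aggVar_div_le_one hs hk
  have h2 : 0 ≤ ζ ^ 2 / s2 k := div_nonneg (sq_nonneg _) (hs k).le
  nlinarith

lemma sum_erase_oracleWeight (hs : ∀ k, 0 < s2 k) (hk : k ∈ c) :
    ∑ l ∈ Finset.univ.erase k, oracleWeight s2 c ζ k l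
      = (1 - aggVar s2 c / s2 k) / (1 + ζ ^ 2 / s2 k * (1 - aggVar s2 c / s2 k)) := by
  have := sum_erase_oracleWeight_mul (s2 := s2) (c := c) (k := k) (ζ := ζ) fun _ => 1
  simp only [mul_one] at this
  rw [this, ← Finset.sum_div, sum_erase_aggVar_div hs hk]

lemma oracleWeight_mem_stdSimplex (hs : ∀ k, 0 < s2 k) (hk : k ∈ c) :
    oracleWeight s2 c ζ k ∈ stdSimplex ℝ (Fin B) := by
  have hD := one_le_oracleDenom (ζ := ζ) hs hk
  have hA := aggVar_pos hs ⟨k, hk⟩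
  refine ⟨fun l => ?_, ?_⟩
  · rw [oracleWeight]
    split_ifs
    · have : (1 - aggVar s2 c / s2 k) / (1 + ζ ^ 2 / s2 k * (1 - aggVar s2 c / s2 k)) ≤ 1 := by
        rw [div_le_one (by linarith)]
        have : 0 ≤ aggVar s2 c / s2 k := (div_pos hA (hs k)).le
        linarith
      linarith
    · exact div_nonneg (div_pos hA (hs l)).le (by linarith)
    · exact le_rfl
  · rw [← Finset.add_sum_erase _ _ (Finset.mem_univ k), sum_erase_oracleWeight hs hk, oracleWeight,
      if_pos rfl]
    ring

variable {μ : Fin B → EuclideanSpace ℝ (Fin d)}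

lemma norm_sub_le_groupDiam {k l : Fin B} (hk : k ∈ c) (hl : l ∈ c) :
    ‖μ l - μ k‖ ≤ groupDiam μ c := by
  rw [← dist_eq_norm]
  exact Metric.dist_le_diam_of_mem ((c.finite_toSet.image μ).isBounded)
    (Set.mem_image_of_mem μ hl) (Set.mem_image_of_mem μ hk)

lemma groupDiam_nonneg : 0 ≤ groupDiam μ c := Metric.diam_nonneg

/-- The oracle weights attain the oracle bound. -/
lemma oracleWeight_risk_le (hs : ∀ k, 0 < s2 k) (hk : k ∈ c) :
    ∑ l, oracleWeight s2 c (groupDiam μ c) k l ^ 2 * s2 l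
        + ‖∑ l, oracleWeight s2 c (groupDiam μ c) k l • (μ l - μ k)‖ ^ 2
      ≤ s2 k * oracleBound (groupDiam μ c ^ 2 / s2 k) (aggVar s2 c / s2 k) := by
  set ζ := groupDiam μ c with hζ
  have hζ0 : 0 ≤ ζ := groupDiam_nonneg
  set w := oracleWeight s2 c ζ k with hw
  have hwS : w ∈ stdSimplex ℝ (Fin B) := oracleWeight_mem_stdSimplex hs hk
  have hν1 := aggVar_div_le_one hs hk
  have hA := aggVar_pos hs ⟨k, hk⟩
  have hD := one_le_oracleDenom (ζ := ζ) hs hk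
  have hsum := sum_erase_oracleWeight (ζ := ζ) hs hk
  have hwk : w k = 1 - (1 - aggVar s2 c / s2 k)
      / (1 + ζ ^ 2 / s2 k * (1 - aggVar s2 c / s2 k)) := if_pos rfl
  have hsk := hs k
  set ν := aggVar s2 c / s2 k with hν
  set τ := ζ ^ 2 / s2 k with hτ
  set D := 1 + τ * (1 - ν) with hDdef
  have hτ0 : 0 ≤ τ := div_nonneg (sq_nonneg _) hsk.le
  have hAν : aggVar s2 c = ν * s2 k := by rw [hν]; field_simp
  have hζτ : ζ ^ 2 = τ * s2 k := by rw [hτ]; field_simp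
  have hD0 : 0 < D := by linarith
  -- The weights are `(1 - 1/D)` times the vertex at `k` plus `1/D` times the inverse-variance
  -- weights `p`. For a step `λ` towards `p`, variance plus worst bias is `s2 k` times `1 - 2 λ (1 -
  -- ν) + λ² (1 - ν) D`, minimised at `λ = 1/D` with value `1 - (1 - ν) / D`, which is `oracleBound
  -- τ ν`.
  have hvar : ∑ l, w l ^ 2 * s2 l = s2 k * (w k ^ 2 + ν * (1 - ν) / D ^ 2) := by
    rw [← Finset.add_sum_erase _ _ (Finset.mem_univ k)]
    have h1 : ∑ l ∈ Finset.univ.erase k, w l ^ 2 * s2 l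
        = ∑ l ∈ Finset.univ.erase k, w l * (w l * s2 l) :=
      Finset.sum_congr rfl fun l _ => by ring
    have h2 : ∑ l ∈ Finset.univ.erase k, w l * (w l * s2 l)
        = ∑ l ∈ c.erase k, aggVar s2 c / s2 l * (aggVar s2 c / D ^ 2) := by
      rw [hw, sum_erase_oracleWeight_mul (fun l => oracleWeight s2 c ζ k l * s2 l)]
      refine Finset.sum_congr rfl fun l hl => ?_
      rw [oracleWeight, if_neg (Finset.ne_of_mem_erase hl), if_pos (Finset.mem_of_mem_erase hl)]
      have := (hs l).ne'
      change aggVar s2 c / s2 l / D * (aggVar s2 c / s2 l / D * s2 l) = _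
      field_simp
    rw [h1, h2, ← Finset.sum_mul, sum_erase_aggVar_div hs hk, ← hν, hAν]
    ring
  have hbias : ‖∑ l, w l • (μ l - μ k)‖ ≤ (1 - ν) / D * ζ := by
    rw [← Finset.add_sum_erase _ _ (Finset.mem_univ k), sub_self, smul_zero, zero_add]
    calc ‖∑ l ∈ Finset.univ.erase k, w l • (μ l - μ k)‖
        ≤ ∑ l ∈ Finset.univ.erase k, w l * ‖μ l - μ k‖ := by
          refine (norm_sum_le _ _).trans (le_of_eq (Finset.sum_congr rfl fun l _ => ?_))
          rw [norm_smul, Real.norm_of_nonneg (hwS.1 l)]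
      _ = ∑ l ∈ c.erase k, aggVar s2 c / s2 l / D * ‖μ l - μ k‖ :=
          sum_erase_oracleWeight_mul fun l => ‖μ l - μ k‖
      _ ≤ ∑ l ∈ c.erase k, aggVar s2 c / s2 l / D * ζ := by
          refine Finset.sum_le_sum fun l hl => mul_le_mul_of_nonneg_left
            (norm_sub_le_groupDiam hk (Finset.mem_of_mem_erase hl))
            (div_nonneg (div_pos hA (hs l)).le hD0.le)
      _ = (1 - ν) / D * ζ := by
          rw [← Finset.sum_mul, ← Finset.sum_div, sum_erase_aggVar_div hs hk]
  have hbias2 : ‖∑ l, w l • (μ l - μ k)‖ ^ 2 ≤ s2 k * (((1 - ν) / D) ^ 2 * τ) := by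
    have := pow_le_pow_left₀ (norm_nonneg _) hbias 2
    rw [mul_pow, hζτ] at this
    linarith
  rw [hvar]
  refine (add_le_add_right hbias2 _).trans (le_of_eq ?_)
  rw [← mul_add, hwk]
  congr 1
  have h1τ : 0 < 1 + τ := by linarith
  rw [oracleBound, ← hDdef]
  field_simp
  rw [hDdef]
  ring

/-- The penalty of the oracle weights. -/
lemma oracleWeight_penalty_le (hs : ∀ k, 0 < s2 k) (hk : k ∈ c) :
    ∑ l ∈ Finset.univ.erase k, oracleWeight s2 c (groupDiam μ c) k l
        * (√(s2 l) + ‖μ l - μ k‖ + √(s2 k))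
      ≤ √(s2 k) * (∑ l ∈ c, aggVar s2 c * (1 / √(s2 l) * (1 / √(s2 k))) + 2) := by
  set ζ := groupDiam μ c with hζ
  have hζ0 : 0 ≤ ζ := groupDiam_nonneg
  have hν1 := aggVar_div_le_one hs hk
  have hA := aggVar_pos hs ⟨k, hk⟩
  have hD := one_le_oracleDenom (ζ := ζ) hs hk
  have hsk := hs k
  rw [sum_erase_oracleWeight_mul]
  set ν := aggVar s2 c / s2 k with hν
  set D := 1 + ζ ^ 2 / s2 k * (1 - ν) with hDd
  set r := √(s2 k) with hr
  have hr0 : 0 < r := Real.sqrt_pos.2 hsk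
  have hr2 : r ^ 2 = s2 k := Real.sq_sqrt hsk.le
  have hν0 : 0 < ν := div_pos hA hsk
  have hD0 : 0 < D := by linarith
  -- A large diameter does no harm: `D` grows like `ζ² / r²` times `1 - ν`, and `ζ ≤ r + ζ² / r`.
  have hmain : (1 - ν) / D * (ζ + r) ≤ 2 * r := by
    rw [div_mul_eq_mul_div, div_le_iff₀ hD0]
    have e : r * D = r + ζ ^ 2 / r * (1 - ν) := by
      rw [hDd, ← hr2]; field_simp
    have hq : ζ ≤ r + ζ ^ 2 / r := by
      have h1 : ζ * r ≤ r ^ 2 + ζ ^ 2 := by nlinarith [sq_nonneg (ζ - r), sq_nonneg ζ, sq_nonneg r]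
      have h2 : r + ζ ^ 2 / r = (r ^ 2 + ζ ^ 2) / r := by field_simp
      rw [h2, le_div_iff₀ hr0]
      exact h1
    have h3 : (1 - ν) * ζ ≤ (1 - ν) * (r + ζ ^ 2 / r) :=
      mul_le_mul_of_nonneg_left hq (by linarith)
    have h4 : 0 ≤ ζ ^ 2 / r * (1 - ν) := mul_nonneg (by positivity) (by linarith)
    nlinarith
  calc ∑ l ∈ c.erase k, aggVar s2 c / s2 l / D * (√(s2 l) + ‖μ l - μ k‖ + r)
      ≤ ∑ l ∈ c.erase k, (aggVar s2 c * (1 / √(s2 l)) + aggVar s2 c / s2 l / D * (ζ + r)) := by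
        refine Finset.sum_le_sum fun l hl => ?_
        have hsl := hs l
        have hq0 : 0 < √(s2 l) := Real.sqrt_pos.2 hsl
        have h1 : aggVar s2 c / s2 l / D * √(s2 l) ≤ aggVar s2 c * (1 / √(s2 l)) := by
          have e : aggVar s2 c * (1 / √(s2 l)) = aggVar s2 c / s2 l * √(s2 l) := by
            have := Real.sq_sqrt hsl.le
            field_simp
            nlinarith
          rw [e]
          exact mul_le_mul_of_nonneg_right (div_le_self (div_pos hA hsl).le hD) hq0.le
        have h2 := norm_sub_le_groupDiam (μ := μ) hk (Finset.mem_of_mem_erase hl)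
        have h3 : aggVar s2 c / s2 l / D * (‖μ l - μ k‖ + r)
            ≤ aggVar s2 c / s2 l / D * (ζ + r) := by gcongr
        rw [add_assoc, mul_add]
        exact add_le_add h1 h3
    _ = ∑ l ∈ c.erase k, aggVar s2 c * (1 / √(s2 l)) + (1 - ν) / D * (ζ + r) := by
        rw [Finset.sum_add_distrib, ← Finset.sum_mul (c.erase k) _ (ζ + r), ← Finset.sum_div,
          sum_erase_aggVar_div hs hk]
    _ ≤ ∑ l ∈ c, aggVar s2 c * (1 / √(s2 l)) + 2 * r := by
        gcongr
        exact Finset.erase_subset _ _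
    _ = r * (∑ l ∈ c, aggVar s2 c * (1 / √(s2 l) * (1 / r)) + 2) := by
        rw [mul_add, Finset.mul_sum, mul_comm r 2]
        congr 1
        refine Finset.sum_congr rfl fun l _ => ?_
        field_simp

/-- Cauchy-Schwarz: `(∑ 1/s_k)² ≤ |c| ∑ 1/s_k²`, and `aggVar` is the inverse of the last sum. A
single inner sum can be large when `s_k` is small, but the average over the group is at most 1. -/
lemma sum_sum_aggVar_le (hs : ∀ k, 0 < s2 k) (hc : c.Nonempty) :
    ∑ k ∈ c, ∑ l ∈ c, aggVar s2 c * (1 / √(s2 l) * (1 / √(s2 k))) ≤ c.card := by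
  have h1 : ∑ k ∈ c, ∑ l ∈ c, aggVar s2 c * (1 / √(s2 l) * (1 / √(s2 k)))
      = aggVar s2 c * (∑ k ∈ c, 1 / √(s2 k)) ^ 2 := by
    rw [sq, Finset.sum_mul_sum, Finset.mul_sum, Finset.sum_comm]
    exact Finset.sum_congr rfl fun i _ => by rw [Finset.mul_sum]
  have h2 : (∑ k ∈ c, 1 / √(s2 k)) ^ 2 ≤ c.card * ∑ k ∈ c, 1 / s2 k := by
    refine sq_sum_le_card_mul_sum_sq.trans (le_of_eq ?_)
    congr 1
    refine Finset.sum_congr rfl fun k _ => ?_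
    rw [div_pow, Real.sq_sqrt (hs k).le, one_pow]
  rw [h1]
  calc aggVar s2 c * (∑ k ∈ c, 1 / √(s2 k)) ^ 2
      ≤ aggVar s2 c * (c.card * ∑ k ∈ c, 1 / s2 k) :=
        mul_le_mul_of_nonneg_left h2 (aggVar_pos hs hc).le
    _ = c.card * (aggVar s2 c * ∑ k ∈ c, 1 / s2 k) := by ring
    _ = c.card := by rw [aggVar_mul_sum hs hc, mul_one]

lemma sum_parts_eq {α : Type*} [DecidableEq α] {s : Finset α} (𝒞 : Finpartition s) (f : α → ℝ) :
    ∑ c ∈ 𝒞.parts, ∑ k ∈ c, f k = ∑ k ∈ s, f k := by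
  conv_rhs => rw [← 𝒞.biUnion_parts]
  rw [Finset.sum_biUnion 𝒞.disjoint]
  rfl

/-- Each group contributes at least the sum of its ratios `ν`, which is 1, and there is at least one
group. -/
lemma one_div_le_compoundOracle (hB : 0 < B) (hs : ∀ k, 0 < s2 k)
    (𝒞 : Finpartition (Finset.univ : Finset (Fin B))) (ζ : Finset (Fin B) → ℝ) :
    1 / (B : ℝ) ≤ compoundOracle s2 𝒞 ζ := by
  have hB0 : (0 : ℝ) < B := by exact_mod_cast hB
  obtain ⟨c₀, hc₀, -⟩ := 𝒞.exists_mem (Finset.mem_univ (⟨0, hB⟩ : Fin B))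
  have hterm : ∀ c ∈ 𝒞.parts, (1 : ℝ) ≤
      ∑ k ∈ c, oracleBound (ζ c ^ 2 / s2 k) (aggVar s2 c / s2 k) := by
    intro c hc
    rw [← sum_aggVar_div hs (𝒞.nonempty_of_mem_parts hc)]
    exact Finset.sum_le_sum fun k hk => oracleBound_ge
      (div_nonneg (sq_nonneg _) (hs k).le) (aggVar_div_le_one hs hk)
  rw [compoundOracle]
  refine le_mul_of_one_le_right (by positivity) ((hterm c₀ hc₀).trans ?_)
  exact Finset.single_le_sum
    (f := fun c => ∑ k ∈ c, oracleBound (ζ c ^ 2 / s2 k) (aggVar s2 c / s2 k))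
    (fun c hc => zero_le_one.trans (hterm c hc)) hc₀

end Oracle

/-! ### Relative risks in terms of the effective dimension, and averaging over tasks -/

lemma trace_pos_of_posSemidef {d : ℕ} {S : Matrix (Fin d) (Fin d) ℝ} (hS : S.PosSemidef)
    (h0 : S ≠ 0) : 0 < S.trace :=
  lt_of_le_of_ne hS.trace_nonneg fun h => h0 (hS.trace_eq_zero_iff.1 h.symm)

lemma norm_covOp_pos {d : ℕ} {S : Matrix (Fin d) (Fin d) ℝ} (h0 : S ≠ 0) : 0 < ‖covOp S‖ :=
  norm_pos_iff.2 ((map_ne_zero_iff _ (Matrix.toEuclideanCLM (𝕜 := ℝ)).injective).2 h0)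

lemma effDim_pos {d : ℕ} {S : Matrix (Fin d) (Fin d) ℝ} (hS : S.PosSemidef) (h0 : S ≠ 0) :
    0 < effDim S :=
  div_pos (trace_pos_of_posSemidef hS h0) (norm_covOp_pos h0)

namespace IsGaussianModel

variable {d B : ℕ} {N : Fin B → ℕ} {Ω : Type*} [MeasurableSpace Ω] {P : Measure Ω}
  [IsProbabilityMeasure P] {X : Ω → Bags d B N} {μ : Fin B → EuclideanSpace ℝ (Fin d)}
  {S : Fin B → Matrix (Fin d) (Fin d) ℝ}

lemma naiveRisk_pos (h : IsGaussianModel P X μ S) {k : Fin B} (hN : N k ≠ 0) (h0 : S k ≠ 0) :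
    0 < naiveRisk P X μ k := by
  rw [h.naiveRisk_eq hN]
  exact div_pos (trace_pos_of_posSemidef (h.posSemidef k) h0) (by positivity)

lemma sqrt_norm_mul_trace_div (h : IsGaussianModel P X μ S) {k : Fin B} (hN : N k ≠ 0)
    (h0 : S k ≠ 0) :
    √(‖covOp (S k)‖ * (S k).trace) / N k = naiveRisk P X μ k * (1 / √(effDim (S k))) := by
  have ht := trace_pos_of_posSemidef (h.posSemidef k) h0
  have ho := norm_covOp_pos h0
  have hn : (0 : ℝ) < N k := by positivity
  rw [h.naiveRisk_eq hN, effDim, Real.sqrt_mul ho.le, Real.sqrt_div ht.le]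
  have h1 := Real.sqrt_pos.2 ht
  have h2 := Real.sqrt_pos.2 ho
  have h3 := Real.sq_sqrt ht.le
  change _ = (S k).trace / N k * (1 / (√(S k).trace / √‖covOp (S k)‖))
  field_simp
  rw [h3]

lemma sqrt_norm_div_mul_sqrt_naiveRisk (h : IsGaussianModel P X μ S) {k : Fin B} (hN : N k ≠ 0) :
    √(‖covOp (S k)‖ / N k) * √(naiveRisk P X μ k) = √(‖covOp (S k)‖ * (S k).trace) / N k := by
  have hn : (0 : ℝ) < N k := by positivity
  rw [h.naiveRisk_eq hN, ← Real.sqrt_mul (by positivity),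
    show ‖covOp (S k)‖ / N k * ((S k).trace / N k) = ‖covOp (S k)‖ * (S k).trace / (N k : ℝ) ^ 2 by
      field_simp, Real.sqrt_div' _ (by positivity), Real.sqrt_sq hn.le]

/-- Relative risk of a task, compared with the oracle weights inside a group containing it. -/
lemma risk_div_naiveRisk_le (h : IsGaussianModel P X μ S) (hS : ∀ k, S k ≠ 0)
    (hN : ∀ k, 1 < N k) {k : Fin B} {u : ℝ} (hu : 1 ≤ u) (hun : u ≤ ((N k : ℝ) - 1) / 2)
    {w : Ω → Fin B → ℝ} (hwm : AEMeasurable w P) (hw : ∀ᵐ o ∂P, IsQWeight u (X o) k (w o))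
    {c : Finset (Fin B)} (hk : k ∈ c) :
    risk P (fun o => aggregate (X o) (w o)) (μ k) / naiveRisk P X μ k
      ≤ oracleBound (groupDiam μ c ^ 2 / naiveRisk P X μ k)
          (aggVar (naiveRisk P X μ) c / naiveRisk P X μ k)
        + u * (1 / √(effDim (S k))) * (16 * ∑ l ∈ c, aggVar (naiveRisk P X μ) c
            * (1 / √(naiveRisk P X μ l) * (1 / √(naiveRisk P X μ k))) + 78)
        + 10 * (B * Real.exp (-(3 / 2 * u))) := by
  have hN0 : ∀ k, N k ≠ 0 := fun k => by have := hN k; omega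
  have hs : ∀ k, 0 < naiveRisk P X μ k := fun k => h.naiveRisk_pos (hN0 k) (hS k)
  have hmain := h.risk_aggregate_le hN (by linarith) hun hwm hw
    (oracleWeight_mem_stdSimplex (ζ := groupDiam μ c) hs hk)
  have horacle := oracleWeight_risk_le (μ := μ) hs hk
  have hpen := oracleWeight_penalty_le (μ := μ) hs hk
  set s := naiveRisk P X μ k with hsdef
  set g := 1 / √(effDim (S k)) with hg
  have hg0 : 0 ≤ g := by positivity
  have e1 := h.sqrt_norm_mul_trace_div (hN0 k) (hS k)
  have e2 := h.sqrt_norm_div_mul_sqrt_naiveRisk (hN0 k)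
  rw [e2, e1] at hmain
  rw [e1] at e2
  rw [← hsdef] at e2
  set T := ∑ l ∈ c, aggVar (naiveRisk P X μ) c
            * (1 / √(naiveRisk P X μ l) * (1 / √s)) with hT
  have hT0 : 0 ≤ T := Finset.sum_nonneg fun l _ =>
    mul_nonneg (aggVar_pos hs ⟨k, hk⟩).le (by positivity)
  set E := Real.exp (-(3 / 2 * u)) with hE
  have hE0 : 0 < E := Real.exp_pos _
  have hpen2 : ∑ l ∈ Finset.univ.erase k, oracleWeight (naiveRisk P X μ) c (groupDiam μ c) k l
      * (√(‖covOp (S k)‖ / N k) * (√(naiveRisk P X μ l) + ‖μ l - μ k‖ + √s))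
      ≤ s * g * (T + 2) := by
    rw [← e2, mul_assoc]
    refine le_of_eq_of_le ?_ (mul_le_mul_of_nonneg_left hpen (Real.sqrt_nonneg _))
    rw [Finset.mul_sum]
    exact Finset.sum_congr rfl fun l _ => by ring
  have hsu : √u ≤ u := Real.sqrt_le_iff.2 ⟨by linarith, by nlinarith⟩
  have h2 : √2 ≤ 1.42 := Real.sqrt_le_iff.2 ⟨by norm_num, by norm_num⟩
  have hx0 : 0 ≤ s * g := mul_nonneg (hs k).le hg0
  -- The constant 78 is `32 + 30 + 16`: the part `16 * 2` of the penalty of the oracle weights, `21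
  -- √2 ≤ 30` from the fluctuations, and 16 from the remainder in direction `μ̂_k - μ k`. The 10
  -- bounds `7 √2`.
  have t1 : 16 * √u * ∑ l ∈ Finset.univ.erase k,
      oracleWeight (naiveRisk P X μ) c (groupDiam μ c) k l
      * (√(‖covOp (S k)‖ / N k) * (√(naiveRisk P X μ l) + ‖μ l - μ k‖ + √s))
      ≤ 16 * u * (s * g * (T + 2)) := by
    refine (mul_le_mul_of_nonneg_left hpen2 (by positivity)).trans ?_
    gcongr
  have t2 : 21 * √2 * (s * g) ≤ 30 * u * (s * g) := by gcongr ?_ * _; linarith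
  have t3 : 16 * √u * (s * g) ≤ 16 * u * (s * g) := by gcongr
  have t4 : 7 * s * (B * (√2 * E)) ≤ 10 * s * (B * E) := by
    have : 0 ≤ s * (B * E) := mul_nonneg (hs k).le (by positivity)
    nlinarith
  rw [div_le_iff₀ (hs k)]
  linarith

end IsGaussianModel

theorem sum_relativeRisk_le {d B : ℕ} {N : Fin B → ℕ} {Ω : Type*} [MeasurableSpace Ω]
    {P : Measure Ω} [IsProbabilityMeasure P] {X : Ω → Bags d B N}
    {μ : Fin B → EuclideanSpace ℝ (Fin d)} {S : Fin B → Matrix (Fin d) (Fin d) ℝ} {u : ℝ}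
    {W : Fin B → Ω → Fin B → ℝ} (hB : 0 < B) (h : IsGaussianModel P X μ S) (hS : ∀ k, S k ≠ 0)
    (hN : ∀ k, 1 < N k) (hu : 1 ≤ u) (hBu : Real.log (17 * (B : ℝ)) ≤ u)
    (hun : ∀ k, u ≤ ((N k : ℝ) - 1) / 2) (hWm : ∀ k, AEMeasurable (W k) P)
    (hW : ∀ k, ∀ᵐ o ∂P, IsQWeight u (X o) k (W k o))
    (𝒞 : Finpartition (Finset.univ : Finset (Fin B))) :
    1 / (B : ℝ) * ∑ k, risk P (fun o => aggregate (X o) (W k o)) (μ k) / naiveRisk P X μ k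
      ≤ (1 + 94 * (B : ℝ) * Real.exp (-u / 2)) *
        (compoundOracle (naiveRisk P X μ) 𝒞 (groupDiam μ)
          + 94 * (u / ⨅ k, √(effDim (S k)))) := by
  have hB0 : (0 : ℝ) < B := by exact_mod_cast hB
  have : Nonempty (Fin B) := ⟨⟨0, hB⟩⟩
  have hs : ∀ k, 0 < naiveRisk P X μ k := fun k =>
    h.naiveRisk_pos (by have := hN k; omega) (hS k)
  set δ := ⨅ k, √(effDim (S k)) with hδ
  have hδ0 : 0 < δ := by
    obtain ⟨k, hk⟩ := exists_eq_ciInf_of_finite (f := fun k => √(effDim (S k)))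
    rw [hδ, ← hk]
    exact Real.sqrt_pos.2 (effDim_pos (h.posSemidef k) (hS k))
  set E := Real.exp (-(3 / 2 * u)) with hE
  have hgroup : ∀ c ∈ 𝒞.parts, ∑ k ∈ c,
      risk P (fun o => aggregate (X o) (W k o)) (μ k) / naiveRisk P X μ k
      ≤ ∑ k ∈ c, oracleBound (groupDiam μ c ^ 2 / naiveRisk P X μ k)
          (aggVar (naiveRisk P X μ) c / naiveRisk P X μ k)
        + ∑ _k ∈ c, (94 * (u / δ) + 10 * (B * E)) := by
    intro c hc
    have hcne := 𝒞.nonempty_of_mem_parts hc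
    set T : Fin B → ℝ := fun k => ∑ l ∈ c, aggVar (naiveRisk P X μ) c
            * (1 / √(naiveRisk P X μ l) * (1 / √(naiveRisk P X μ k))) with hT
    have hT0 : ∀ k, 0 ≤ T k := fun k => Finset.sum_nonneg fun l _ =>
      mul_nonneg (aggVar_pos hs hcne).le (by positivity)
    have hTsum : ∑ k ∈ c, T k ≤ c.card := sum_sum_aggVar_le hs hcne
    calc ∑ k ∈ c, risk P (fun o => aggregate (X o) (W k o)) (μ k) / naiveRisk P X μ k
        ≤ ∑ k ∈ c, (oracleBound (groupDiam μ c ^ 2 / naiveRisk P X μ k)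
            (aggVar (naiveRisk P X μ) c / naiveRisk P X μ k)
            + (u / δ * (16 * T k + 78) + 10 * (B * E))) := by
          refine Finset.sum_le_sum fun k hk => ?_
          have h1 := h.risk_div_naiveRisk_le hS hN hu (hun k) (hWm k) (hW k) hk
          have h2 : u * (1 / √(effDim (S k))) * (16 * T k + 78) ≤ u / δ * (16 * T k + 78) := by
            have h3 : δ ≤ √(effDim (S k)) := ciInf_le (Set.finite_range _).bddBelow k
            have h4 := hT0 k
            rw [mul_one_div]
            gcongr
          linarith
      _ = ∑ k ∈ c, oracleBound (groupDiam μ c ^ 2 / naiveRisk P X μ k)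
            (aggVar (naiveRisk P X μ) c / naiveRisk P X μ k)
          + (u / δ * (16 * ∑ k ∈ c, T k + 78 * c.card) + c.card * (10 * (B * E))) := by
          rw [Finset.sum_add_distrib, Finset.sum_add_distrib, ← Finset.mul_sum,
            Finset.sum_add_distrib, ← Finset.mul_sum]
          simp only [Finset.sum_const, nsmul_eq_mul]
          ring
      _ ≤ _ := by
          -- The terms `T k` average to at most 1 over the group, so the constant is `16 + 78 = 94`.
          have h5 : u / δ * (16 * ∑ k ∈ c, T k + 78 * c.card) ≤ u / δ * (94 * c.card) := by
            gcongr
            linarith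
          simp only [Finset.sum_const, nsmul_eq_mul]
          linarith
  have htotal : 1 / (B : ℝ) *
      ∑ k, risk P (fun o => aggregate (X o) (W k o)) (μ k) / naiveRisk P X μ k
      ≤ compoundOracle (naiveRisk P X μ) 𝒞 (groupDiam μ) + (94 * (u / δ) + 10 * (B * E)) := by
    rw [← sum_parts_eq 𝒞]
    refine (mul_le_mul_of_nonneg_left (Finset.sum_le_sum hgroup) (by positivity)).trans ?_
    rw [Finset.sum_add_distrib, sum_parts_eq 𝒞, mul_add, compoundOracle]
    simp only [Finset.sum_const, Finset.card_univ, Fintype.card_fin, nsmul_eq_mul]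
    rw [one_div, inv_mul_cancel_left₀ hB0.ne']
  -- The hypothesis on `u` says `17 B ≤ e^u`: one factor `e^{-u}` of `E` pays for the union bound
  -- and `e^{-u/2}` is left.
  have hexp : B * E ≤ 1 / 17 * Real.exp (-u / 2) := by
    have h1 : 17 * (B : ℝ) ≤ Real.exp u := (Real.log_le_iff_le_exp (by positivity)).1 hBu
    have h2 : E = Real.exp (-u) * Real.exp (-u / 2) := by
      rw [hE, ← Real.exp_add]; congr 1; ring
    have h3 : B * Real.exp (-u) ≤ 1 / 17 := by
      rw [Real.exp_neg, ← div_eq_mul_inv, div_le_iff₀ (Real.exp_pos u)]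
      linarith
    rw [h2, ← mul_assoc]
    gcongr
  have hL := one_div_le_compoundOracle hB hs 𝒞 (groupDiam μ)
  set L := compoundOracle (naiveRisk P X μ) 𝒞 (groupDiam μ)
  -- Since `B * L ≥ 1`, the additive remainder becomes a multiple of the oracle risk; this explains
  -- the factor `B` in the leading constant.
  have hLB : Real.exp (-u / 2) ≤ B * Real.exp (-u / 2) * L := by
    have h1 : 1 ≤ B * L := by
      rw [div_le_iff₀ hB0] at hL
      linarith
    have := Real.exp_pos (-u / 2)
    nlinarith
  have hud : 0 ≤ B * Real.exp (-u / 2) * (u / δ) := by positivity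
  have hep := Real.exp_pos (-u / 2)
  nlinarith

end QAggregation

end

theorem mainTheorem6 :
    ∃ C : ℝ, 0 < C ∧
      ∀ (d B : ℕ) (N : Fin B → ℕ) (Ω : Type*) [MeasurableSpace Ω]
        (P : Measure Ω) [IsProbabilityMeasure P]
        (X : Ω → QAggregation.Bags d B N)
        (μ : Fin B → EuclideanSpace ℝ (Fin d)) (S : Fin B → Matrix (Fin d) (Fin d) ℝ)
        (u₀ : ℝ) (W : Fin B → Ω → Fin B → ℝ),
        0 < B →
        QAggregation.IsGaussianModel P X μ S →
        (∀ k, S k ≠ 0) →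
        Real.log (17 * (B : ℝ)) ≤ u₀ →
        (∀ k, u₀ ≤ ((N k : ℝ) - 1) / 2) →
        (∀ k, AEMeasurable (W k) P) →
        (∀ k, ∀ᵐ o ∂P, QAggregation.IsQWeight u₀ (X o) k (W k o)) →
        (∀ k, Integrable
          (QAggregation.loss (fun o => QAggregation.aggregate (X o) (W k o)) (μ k)) P) ∧
        1 / (B : ℝ) * ∑ k, QAggregation.risk P
            (fun o => QAggregation.aggregate (X o) (W k o)) (μ k)
              / QAggregation.naiveRisk P X μ k
          ≤ (1 + C * (B : ℝ) * Real.exp (-u₀ / 2)) *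
            ⨅ 𝒞 : Finpartition (Finset.univ : Finset (Fin B)),
              (QAggregation.compoundOracle (QAggregation.naiveRisk P X μ) 𝒞
                  (QAggregation.groupDiam μ)
                + C * (u₀ / ⨅ k, √(QAggregation.effDim (S k)))) := by
  refine ⟨94, by norm_num, ?_⟩
  intro d B N Ω _ P _ X μ S u W hB h hS hBu hun hWm hW
  have hB1 : (1 : ℝ) ≤ B := by exact_mod_cast hB
  -- Because `log (17 B) ≥ log 17 > 1`; this allows `√u ≤ u`.
  have hu : 1 ≤ u := by
    refine le_trans ?_ hBu
    rw [Real.le_log_iff_exp_le (by positivity)]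
    have := Real.exp_one_lt_d9
    linarith
  have hN : ∀ k, 1 < N k := fun k => by
    have h1 := hun k
    have : (1 : ℝ) < N k := by linarith
    exact_mod_cast this
  refine ⟨fun k => h.integrable_loss_aggregate (hN k) (hWm k) (hW k), ?_⟩
  -- The nonnegative factor moves inside the infimum, so it suffices to treat each partition
  -- separately.
  rw [Real.mul_iInf_of_nonneg (by positivity)]
  exact le_ciInf fun 𝒞 =>
    QAggregation.sum_relativeRisk_le hB h hS hN hu hBu hun hWm hW 𝒞
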